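/- All vectors and matrices are over $\mathbb F_2$; Pauli operators are taken up to phase and recorded by their $X$- and $Z$-supports. An invertible matrix $U$ stands for the CNOT-type Clifford unitary acting on row vectors of $X$-supports by $x\mapsto xU$ and on $Z$-supports by $z\mapsto zU^{-\mathsf T}$. A permutation is identified with its permutation matrix. **Codes.** Let $h_1\in\mathbb F_2^{m_1\times n_1}$, $h_2\in\mathbb F_2^{m_2\times n_2}$, $h\in\mathbb F_2^{m\times n}$ be arbitrary check matrices of classical codes. The hypergraph product (HGP) code has $H_X=(h_1\otimes 1\mid 1\otimes h_2^{\mathsf T})$, $H_Z=(1\otimes h_2\mid h_1^{\mathsf T}\otimes 1)$. The *left-sector HGP code* is the CSS subsystem code in which the right-sector logical operators $(0\mid a\otimes b)$, with $h_1^{\mathsf T}a=0$ (type $X$), respectively $h_2^{\mathsf T}b=0$ (type $Z$), are gauge operators. Its homological product with $h$ has $$\tilde H_X=(H_X\otimes 1\mid 1\otimes h^{\mathsf T}),\qquad \tilde H_Z=\begin{pmatrix}H_Z\otimes 1&0\\ 1\otimes h&H_X^{\mathsf T}\otimes 1\end{pmatrix}.$$ In the *left-sector homological product code* the gauge operators are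 the right-sector logical operators $(0\mid a\otimes b)$, with $H_X^{\mathsf T}a=0$ (type $X$), respectively $h^{\mathsf T}b=0$ (type $Z$), and those inherited from the gauge operators of the input: $(x\otimes c\mid 0)$ with $x$ an $X$-gauge operator of the input and $hc=0$, and $(z\otimes b\mid 0)$ with $z$ a $Z$-gauge operator of the input and $b$ arbitrary. A nontrivial logical $X$ (respectively $Z$) operator of a subsystem code is an $X$-type ($Z$-type) operator that commutes with all checks and does not lie in the group generated by the checks and gauge operators of its type. The $X$-, $Z$-distances $d_X,d_Z$ are the least weights of such operators ($\infty$ if there are none), and $d=\min(d_X,d_Z)$. **Circuits and faults (free permutations).** In each layer of a circuit the qubits are first permuted physically and then gates (arbitrary CNOT-type gates) act in parallel on disjoint sets of qubits; the other qubits idle. A location is a gate or an idling qubit of a layer, or a qubit before the first layer; permutations are not locations. An elementary fault is an arbitrary Pauli error on the qubits of one location, and it is propagated by the rest of the circuit. A circuit is *distance-preserving* for a CSS subsystem code if the least numbers of elementary faults whose outgoing error has an $X$-part that is a nontrivial logical $X$ operator, has a $Z$-part that is a nontrivial logical $Z$ operator, or commutes with all checks and is a nontrivial logical operator of any type, are exactly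 $d_X$, $d_Z$ and $d$. **Gadgets.** Let $\sigma_1,\sigma_2,\sigma$ be permutations and $w_1,w_2,w$ invertible matrices with $h_i\sigma_i=w_ih_i$ ($i=1,2$) and $h\sigma=wh$. The HGP gadgets are $U_1=(\sigma_1\otimes1)\oplus(w_1\otimes 1)$ and $U_2=(1\otimes\sigma_2)\oplus(1\otimes w_2^{-\mathsf T})$. Put $U=U_1U_2$ (the choice $\sigma_2=1,w_2=1$ or $\sigma_1=1,w_1=1$ gives a single gadget), and let $W$ be any invertible matrix with $H_XU=WH_X$. The inherited gadgets of the homological product are $$\tilde U_{\rm Q}=(U\otimes 1)\oplus(W\otimes 1),\qquad \tilde U_{\rm c}=(1\otimes\sigma)\oplus(1\otimes w^{-\mathsf T}).$$ **Theorem.** 1. Let $\mathcal C$ be a circuit performing $U$ that is distance-preserving for the left-sector HGP code, and let $\mathcal D$ be any circuit on the right sector performing $W\otimes 1$. Then the circuit that runs one copy of $\mathcal C$ on each of the $n$ columns of the left sector in parallel, and $\mathcal D$ on the right sector, performs $\tilde U_{\rm Q}$ and is distance-preserving for the left-sector homological product code. 2. The hypothesis on $\mathcal C$ holds for the standard circuits: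 if $\mathcal C$ permutes the left sector of the HGP code by $\sigma_1\otimes\sigma_2$ and runs any circuit performing $w_1\otimes w_2^{-\mathsf T}$ on its right sector, then $\mathcal C$ performs $U$ and is distance-preserving for the left-sector HGP code. 3. The circuit that permutes the left sector of the homological product code by $1\otimes\sigma$ and runs any circuit performing $1\otimes w^{-\mathsf T}$ on the right sector performs $\tilde U_{\rm c}$ and is distance-preserving for the left-sector homological product code. (Circuits side by side start together; the shorter one is padded with idling.) -/

import Mathlib

open Matrix
open scoped Kronecker

namespace QGadget

/-- The binary field. -/
abbrev F2 : Type := ZMod 2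

/-! ### Vectors on product index sets -/

/-- The Kronecker product `a ⊗ b` of two binary vectors. -/
def tens {ι κ : Type*} (a : ι → F2) (b : κ → F2) : ι × κ → F2 := fun p => a p.1 * b p.2

/-- The vector `(v | 0)`. -/
def inL {ι κ : Type*} (v : ι → F2) : ι ⊕ κ → F2 := Sum.elim v 0

/-- The vector `(0 | v)`. -/
def inR {ι κ : Type*} (v : κ → F2) : ι ⊕ κ → F2 := Sum.elim 0 v

theorem kronecker_mulVec_tens {m n ι κ : Type*} [Fintype ι] [Fintype κ]
    (A : Matrix m ι F2) (B : Matrix n κ F2) (a : ι → F2) (b : κ → F2) :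
    (A ⊗ₖ B) *ᵥ tens a b = tens (A *ᵥ a) (B *ᵥ b) := by
  ext ⟨i, j⟩
  simp only [mulVec, dotProduct, tens, kroneckerMap_apply, Fintype.sum_prod_type,
    Finset.sum_mul_sum]
  refine Finset.sum_congr rfl fun x _ => Finset.sum_congr rfl fun y _ => ?_
  ring

@[simp] theorem tens_zero_left {ι κ : Type*} (b : κ → F2) : tens (0 : ι → F2) b = 0 := by
  ext; simp [tens]

@[simp] theorem tens_zero_right {ι κ : Type*} (a : ι → F2) : tens a (0 : κ → F2) = 0 := by
  ext; simp [tens]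

/-! ### CSS subsystem codes

Pauli operators of pure type are recorded by their supports.  A CSS subsystem code is a CSS
code (check matrices `HX`, `HZ` with `HX * HZᵀ = 0`) some of whose logical operators are
designated as gauge operators.  `gaugeX`, `gaugeZ` hold the designated operators. -/

structure SubsystemCode (rX rZ ι : Type*) [Fintype rX] [Fintype rZ] [Fintype ι] where
  HX : Matrix rX ι F2
  HZ : Matrix rZ ι F2
  comm : HX * HZᵀ = 0
  gaugeX : Submodule F2 (ι → F2)
  gaugeZ : Submodule F2 (ι → F2)
  gaugeX_comm : ∀ v ∈ gaugeX, HZ *ᵥ v = 0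
  gaugeZ_comm : ∀ v ∈ gaugeZ, HX *ᵥ v = 0

namespace SubsystemCode

variable {rX rZ ι : Type*} [Fintype rX] [Fintype rZ] [Fintype ι]

/-- The `X`-type gauge group: generated by the `X` checks and the designated operators. -/
def groupX (C : SubsystemCode rX rZ ι) : Submodule F2 (ι → F2) :=
  Submodule.span F2 (Set.range C.HX.row) ⊔ C.gaugeX

/-- The `Z`-type gauge group. -/
def groupZ (C : SubsystemCode rX rZ ι) : Submodule F2 (ι → F2) :=
  Submodule.span F2 (Set.range C.HZ.row) ⊔ C.gaugeZ

/-- `x` is the support of a nontrivial (dressed) logical `X` operator. -/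
def IsLogicalX (C : SubsystemCode rX rZ ι) (x : ι → F2) : Prop :=
  C.HZ *ᵥ x = 0 ∧ x ∉ C.groupX

/-- `z` is the support of a nontrivial (dressed) logical `Z` operator. -/
def IsLogicalZ (C : SubsystemCode rX rZ ι) (z : ι → F2) : Prop :=
  C.HX *ᵥ z = 0 ∧ z ∉ C.groupZ

/-- `X` distance: least weight of a nontrivial logical `X` operator (`⊤` if there is none). -/
noncomputable def distX (C : SubsystemCode rX rZ ι) : ℕ∞ :=
  sInf {n : ℕ∞ | ∃ x, C.IsLogicalX x ∧ n = (hammingNorm x : ℕ)}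

/-- `Z` distance. -/
noncomputable def distZ (C : SubsystemCode rX rZ ι) : ℕ∞ :=
  sInf {n : ℕ∞ | ∃ z, C.IsLogicalZ z ∧ n = (hammingNorm z : ℕ)}

/-- The code distance. -/
noncomputable def dist (C : SubsystemCode rX rZ ι) : ℕ∞ := min C.distX C.distZ

end SubsystemCode

/-! ### Left-sector hypergraph product codes -/

section HGP

variable {B₁ S₁ B₂ S₂ : Type*} [Fintype B₁] [Fintype S₁] [Fintype B₂] [Fintype S₂]
  [DecidableEq B₁] [DecidableEq S₁] [DecidableEq B₂] [DecidableEq S₂]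

/-- `H_X = (h₁ ⊗ 1 | 1 ⊗ h₂ᵀ)`; the left qubits are `B₁ × B₂`, the right ones `S₁ × S₂`. -/
def hgpX (h₁ : Matrix S₁ B₁ F2) (h₂ : Matrix S₂ B₂ F2) :
    Matrix (S₁ × B₂) ((B₁ × B₂) ⊕ (S₁ × S₂)) F2 :=
  fromCols (h₁ ⊗ₖ (1 : Matrix B₂ B₂ F2)) ((1 : Matrix S₁ S₁ F2) ⊗ₖ h₂ᵀ)

/-- `H_Z = (1 ⊗ h₂ | h₁ᵀ ⊗ 1)`. -/
def hgpZ (h₁ : Matrix S₁ B₁ F2) (h₂ : Matrix S₂ B₂ F2) :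
    Matrix (B₁ × S₂) ((B₁ × B₂) ⊕ (S₁ × S₂)) F2 :=
  fromCols ((1 : Matrix B₁ B₁ F2) ⊗ₖ h₂) (h₁ᵀ ⊗ₖ (1 : Matrix S₂ S₂ F2))

theorem F2_add_self {m n : Type*} (A : Matrix m n F2) : A + A = 0 := by
  ext i j; exact CharTwo.add_self_eq_zero _

theorem hgp_comm (h₁ : Matrix S₁ B₁ F2) (h₂ : Matrix S₂ B₂ F2) :
    hgpX h₁ h₂ * (hgpZ h₁ h₂)ᵀ = 0 := by
  simp only [hgpX, hgpZ, transpose_fromCols, fromCols_mul_fromRows, ← kroneckerMap_transpose,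
    transpose_one, transpose_transpose, ← mul_kronecker_mul, Matrix.mul_one, Matrix.one_mul]
  exact F2_add_self _

/-- The left-sector hypergraph product code: the right-sector logical operators
`(0 | a ⊗ b)` with `h₁ᵀ a = 0` (type `X`) and `(0 | a ⊗ b)` with `h₂ᵀ b = 0` (type `Z`) are gauge
operators.  (In the canonical basis the unconstrained factor runs through unit vectors that
represent a basis of the quotient by the image of `h₂`, respectively `h₁`; for a factor in that
image the operator is a stabilizer, so the gauge group is the same.) -/
def leftHGP (h₁ : Matrix S₁ B₁ F2) (h₂ : Matrix S₂ B₂ F2) :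
    SubsystemCode (S₁ × B₂) (B₁ × S₂) ((B₁ × B₂) ⊕ (S₁ × S₂)) where
  HX := hgpX h₁ h₂
  HZ := hgpZ h₁ h₂
  comm := hgp_comm h₁ h₂
  gaugeX := Submodule.span F2
    {v | ∃ (a : S₁ → F2) (b : S₂ → F2), h₁ᵀ *ᵥ a = 0 ∧ v = inR (tens a b)}
  gaugeZ := Submodule.span F2
    {v | ∃ (a : S₁ → F2) (b : S₂ → F2), h₂ᵀ *ᵥ b = 0 ∧ v = inR (tens a b)}
  gaugeX_comm := by
    intro v hv
    induction hv using Submodule.span_induction with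
    | mem v hv =>
      obtain ⟨a, b, ha, rfl⟩ := hv
      simp [hgpZ, fromCols_mulVec, inR, kronecker_mulVec_tens, ha]
    | zero => simp
    | add x y _ _ hx hy => rw [mulVec_add, hx, hy, add_zero]
    | smul c x _ hx => rw [mulVec_smul, hx, smul_zero]
  gaugeZ_comm := by
    intro v hv
    induction hv using Submodule.span_induction with
    | mem v hv =>
      obtain ⟨a, b, hb, rfl⟩ := hv
      simp [hgpX, fromCols_mulVec, inR, kronecker_mulVec_tens, hb]
    | zero => simp
    | add x y _ _ hx hy => rw [mulVec_add, hx, hy, add_zero]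
    | smul c x _ hx => rw [mulVec_smul, hx, smul_zero]

/-- The gadget `U₁ = (σ₁ ⊗ 1) ⊕ (w₁ ⊗ 1)`. -/
def hgpU₁ (σ₁ : Equiv.Perm B₁) (w₁ : GeneralLinearGroup S₁ F2) :
    Matrix ((B₁ × B₂) ⊕ (S₁ × S₂)) ((B₁ × B₂) ⊕ (S₁ × S₂)) F2 :=
  fromBlocks (σ₁.permMatrix F2 ⊗ₖ (1 : Matrix B₂ B₂ F2)) 0 0
    (w₁.val ⊗ₖ (1 : Matrix S₂ S₂ F2))

/-- The gadget `U₂ = (1 ⊗ σ₂) ⊕ (1 ⊗ w₂⁻ᵀ)`. -/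
def hgpU₂ (σ₂ : Equiv.Perm B₂) (w₂ : GeneralLinearGroup S₂ F2) :
    Matrix ((B₁ × B₂) ⊕ (S₁ × S₂)) ((B₁ × B₂) ⊕ (S₁ × S₂)) F2 :=
  fromBlocks ((1 : Matrix B₁ B₁ F2) ⊗ₖ σ₂.permMatrix F2) 0 0
    ((1 : Matrix S₁ S₁ F2) ⊗ₖ (w₂⁻¹).valᵀ)

end HGP

/-! ### Left-sector (quantum × classical) homological product codes -/

section HP

set_option linter.unusedSectionVars false

variable {rX rZ ι B S : Type*} [Fintype rX] [Fintype rZ] [Fintype ι] [Fintype B] [Fintype S]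
  [DecidableEq rX] [DecidableEq ι] [DecidableEq B] [DecidableEq S]

/-- `(H_X ⊗ 1 | 1 ⊗ hᵀ)`; the left qubits are `ι × B`, the right ones `rX × S`. -/
def prodX (HX : Matrix rX ι F2) (h : Matrix S B F2) :
    Matrix (rX × B) ((ι × B) ⊕ (rX × S)) F2 :=
  fromCols (HX ⊗ₖ (1 : Matrix B B F2)) ((1 : Matrix rX rX F2) ⊗ₖ hᵀ)

/-- The `Z` checks `(H_Z ⊗ 1 | 0)` and `(1 ⊗ h | H_Xᵀ ⊗ 1)`. -/
def prodZ (HX : Matrix rX ι F2) (HZ : Matrix rZ ι F2) (h : Matrix S B F2) :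
    Matrix ((rZ × B) ⊕ (ι × S)) ((ι × B) ⊕ (rX × S)) F2 :=
  fromBlocks (HZ ⊗ₖ (1 : Matrix B B F2)) 0
    ((1 : Matrix ι ι F2) ⊗ₖ h) (HXᵀ ⊗ₖ (1 : Matrix S S F2))

theorem prod_comm (HX : Matrix rX ι F2) (HZ : Matrix rZ ι F2) (h : Matrix S B F2)
    (H : HX * HZᵀ = 0) : prodX HX h * (prodZ HX HZ h)ᵀ = 0 := by
  simp only [prodX, prodZ, fromBlocks_transpose, transpose_zero, ← kroneckerMap_transpose,
    transpose_one, transpose_transpose, fromCols_mul_fromBlocks, ← mul_kronecker_mul,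
    Matrix.mul_one, Matrix.one_mul, H, Matrix.mul_zero, add_zero, zero_kronecker, F2_add_self]
  ext i (j | j) <;> rfl

/-- The left-sector homological product of a CSS (subsystem) code `C` with the classical code
with check matrix `h`.  Its logical operators are, up to stabilizers, the products
`(x ⊗ c | 0)`, `(z ⊗ b | 0)` of logical operators of `C` with codewords `c`, respectively with
vectors `b`.  Gauge operators are the products of the same shape built from gauge operators of
`C`, and the right-sector logical operators `(0 | a ⊗ b)` with `H_Xᵀ a = 0` (type `X`),
respectively `hᵀ b = 0` (type `Z`). -/
def leftProduct (C : SubsystemCode rX rZ ι) (h : Matrix S B F2) :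
    SubsystemCode (rX × B) ((rZ × B) ⊕ (ι × S)) ((ι × B) ⊕ (rX × S)) where
  HX := prodX C.HX h
  HZ := prodZ C.HX C.HZ h
  comm := prod_comm _ _ _ C.comm
  gaugeX := Submodule.span F2
    ({v | ∃ x ∈ C.gaugeX, ∃ c : B → F2, h *ᵥ c = 0 ∧ v = inL (tens x c)} ∪
     {v | ∃ (a : rX → F2) (b : S → F2), C.HXᵀ *ᵥ a = 0 ∧ v = inR (tens a b)})
  gaugeZ := Submodule.span F2
    ({v | ∃ z ∈ C.gaugeZ, ∃ b : B → F2, v = inL (tens z b)} ∪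
     {v | ∃ (a : rX → F2) (b : S → F2), hᵀ *ᵥ b = 0 ∧ v = inR (tens a b)})
  gaugeX_comm := by
    intro v hv
    induction hv using Submodule.span_induction with
    | mem v hv =>
      rcases hv with ⟨x, hx, c, hc, rfl⟩ | ⟨a, b, ha, rfl⟩
      · simp [prodZ, fromBlocks_mulVec, inL, kronecker_mulVec_tens, hc,
          C.gaugeX_comm x hx]
      · simp [prodZ, fromBlocks_mulVec, inR, kronecker_mulVec_tens, ha]
    | zero => simp
    | add x y _ _ hx hy => rw [mulVec_add, hx, hy, add_zero]
    | smul c x _ hx => rw [mulVec_smul, hx, smul_zero]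
  gaugeZ_comm := by
    intro v hv
    induction hv using Submodule.span_induction with
    | mem v hv =>
      rcases hv with ⟨z, hz, b, rfl⟩ | ⟨a, b, hb, rfl⟩
      · simp [prodX, fromCols_mulVec, inL, kronecker_mulVec_tens,
          C.gaugeZ_comm z hz]
      · simp [prodX, fromCols_mulVec, inR, kronecker_mulVec_tens, hb]
    | zero => simp
    | add x y _ _ hx hy => rw [mulVec_add, hx, hy, add_zero]
    | smul c x _ hx => rw [mulVec_smul, hx, smul_zero]

/-- The inherited gadget `(U ⊗ 1) ⊕ (W ⊗ 1)`. -/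
def prodUQ (B S : Type*) [DecidableEq B] [DecidableEq S]
    (U : Matrix ι ι F2) (W : GeneralLinearGroup rX F2) :
    Matrix ((ι × B) ⊕ (rX × S)) ((ι × B) ⊕ (rX × S)) F2 :=
  fromBlocks (U ⊗ₖ (1 : Matrix B B F2)) 0 0 (W.val ⊗ₖ (1 : Matrix S S F2))

/-- The inherited gadget `(1 ⊗ σ) ⊕ (1 ⊗ w⁻ᵀ)`. -/
def prodUc (ι rX : Type*) [DecidableEq ι] [DecidableEq rX]
    (σ : Equiv.Perm B) (w : GeneralLinearGroup S F2) :
    Matrix ((ι × B) ⊕ (rX × S)) ((ι × B) ⊕ (rX × S)) F2 :=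
  fromBlocks ((1 : Matrix ι ι F2) ⊗ₖ σ.permMatrix F2) 0 0
    ((1 : Matrix rX rX F2) ⊗ₖ (w⁻¹).valᵀ)

end HP

/-! ### Circuits of permutations and linear reversible gates -/

/-- One layer of a circuit.  First the qubits are physically permuted by `perm`; then gates act in
parallel on disjoint sets of qubits.  `loc i` is the label of the location (gate, or idling
qubit) that qubit `i` takes part in.  The gates are arbitrary invertible linear (`CNOT`-type)
gates: `gate` is their joint action on row vectors of `X` supports, and it does not mix qubits of
different locations. -/
structure Layer (ι : Type*) [Fintype ι] [DecidableEq ι] where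
  perm : Equiv.Perm ι
  loc : ι → ι
  gate : GeneralLinearGroup ι F2
  gate_local : ∀ i j, loc i ≠ loc j → gate.val i j = 0

/-- A circuit: its layers in temporal order. -/
abbrev Circuit (ι : Type*) [Fintype ι] [DecidableEq ι] := List (Layer ι)

/-- A Pauli operator up to phase: its `X` support and its `Z` support. -/
abbrev Pauli (ι : Type*) := (ι → F2) × (ι → F2)

section Circuits

variable {ι κ : Type*} [Fintype ι] [DecidableEq ι] [Fintype κ] [DecidableEq κ]

/-- The set of qubits on which a Pauli operator is not the identity. -/
def Pauli.supp (p : Pauli ι) : Finset ι :=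
  Finset.univ.filter fun i => p.1 i ≠ 0 ∨ p.2 i ≠ 0

namespace Layer

/-- The layer as a matrix acting on row vectors of `X` supports. -/
def mat (l : Layer ι) : Matrix ι ι F2 := l.perm.permMatrix F2 * l.gate.val

/-- Propagation of a Pauli operator through the layer: permute, then `x ↦ x G`, `z ↦ z G⁻ᵀ`. -/
def act (l : Layer ι) (p : Pauli ι) : Pauli ι :=
  ((p.1 ∘ l.perm.symm) ᵥ* l.gate.val, (p.2 ∘ l.perm.symm) ᵥ* (l.gate⁻¹).valᵀ)

/-- The number of faulty locations when the Pauli error `f` happens in the layer: an elementary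
fault is an arbitrary Pauli error on the qubits of one location.  The permutation is free: it
contributes no location of its own. -/
def faults (l : Layer ι) (f : Pauli ι) : ℕ := (f.supp.image l.loc).card

/-- Only permute; every qubit is its own location. -/
def permute (π : Equiv.Perm ι) : Layer ι where
  perm := π
  loc := id
  gate := 1
  gate_local := fun _ _ h => one_apply_ne h

/-- The layer in which all qubits idle. -/
def idle (ι : Type*) [Fintype ι] [DecidableEq ι] : Layer ι := permute 1

/-- Two layers on disjoint sets of qubits, executed simultaneously. -/
def sum (l : Layer ι) (l' : Layer κ) : Layer (ι ⊕ κ) where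
  perm := Equiv.sumCongr l.perm l'.perm
  loc := Sum.map l.loc l'.loc
  gate :=
    { val := fromBlocks l.gate.val 0 0 l'.gate.val
      inv := fromBlocks (l.gate⁻¹).val 0 0 (l'.gate⁻¹).val
      val_inv := by simp [fromBlocks_multiply]
      inv_val := by simp [fromBlocks_multiply] }
  gate_local := by
    rintro (i | i) (j | j) h
    · exact l.gate_local i j fun e => h (by simp [e])
    · rfl
    · rfl
    · exact l'.gate_local i j fun e => h (by simp [e])

/-- One copy of the layer for each `k : κ`, executed simultaneously. -/
def parallel (κ : Type*) [Fintype κ] [DecidableEq κ] (l : Layer ι) : Layer (ι × κ) where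
  perm := Equiv.prodCongr l.perm (Equiv.refl κ)
  loc := Prod.map l.loc id
  gate :=
    { val := l.gate.val ⊗ₖ (1 : Matrix κ κ F2)
      inv := (l.gate⁻¹).val ⊗ₖ (1 : Matrix κ κ F2)
      val_inv := by rw [← mul_kronecker_mul]; simp
      inv_val := by rw [← mul_kronecker_mul]; simp }
  gate_local := by
    rintro ⟨i, k⟩ ⟨j, k'⟩ h
    by_cases hk : k = k'
    · have : l.gate.val i j = 0 := l.gate_local i j fun e => h (by simp [e, hk])
      simp [kroneckerMap_apply, this]
    · simp [kroneckerMap_apply, one_apply_ne hk]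

end Layer

namespace Circuit

/-- The unitary performed by the circuit, as a matrix acting on row vectors of `X` supports (it
acts on `Z` supports by the inverse transpose). -/
def mat (c : Circuit ι) : Matrix ι ι F2 := (c.map Layer.mat).prod

/-- Two circuits on disjoint sets of qubits, side by side; the shorter one is padded with idling. -/
def sum : Circuit ι → Circuit κ → Circuit (ι ⊕ κ)
  | [], [] => []
  | l :: c, [] => l.sum (Layer.idle κ) :: sum c []
  | [], l' :: c' => (Layer.idle ι).sum l' :: sum [] c'
  | l :: c, l' :: c' => l.sum l' :: sum c c'

/-- One copy of the circuit for each `k : κ`, side by side. -/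
def parallel (κ : Type*) [Fintype κ] [DecidableEq κ] (c : Circuit ι) : Circuit (ι × κ) :=
  c.map (Layer.parallel κ)

/-- `Run c p q n`: from the incoming Pauli error `p`, the noisy circuit `c` can produce the
outgoing Pauli error `q` with `n` elementary faults.  In each layer the present error is propagated
and then multiplied with the error `f` that happens in this layer. -/
inductive Run : Circuit ι → Pauli ι → Pauli ι → ℕ → Prop
  | nil (p : Pauli ι) : Run [] p p 0
  | cons (l : Layer ι) (c : Circuit ι) (p f q : Pauli ι) (n : ℕ) :
      Run c (l.act p + f) q n → Run (l :: c) p q (l.faults f + n)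

/-- The least number of elementary faults that produce an outgoing error with property `P`.
The qubits idle before the first layer, so that an incoming error `p` amounts to one
single-qubit fault on each qubit of its support. -/
noncomputable def faultDistance (c : Circuit ι) (P : Pauli ι → Prop) : ℕ∞ :=
  sInf {d : ℕ∞ | ∃ (p q : Pauli ι) (n : ℕ), Run c p q n ∧ P q ∧ d = (p.supp.card + n : ℕ)}

/-- The circuit is distance-preserving for the code: no fewer elementary faults than the `X`
distance (`Z` distance, distance) of the code effect a nontrivial logical `X` (logical `Z`, any
nontrivial logical) operation, and that many suffice. -/
def DistancePreserving {rX rZ : Type*} [Fintype rX] [Fintype rZ]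
    (C : SubsystemCode rX rZ ι) (c : Circuit ι) : Prop :=
  faultDistance c (fun q => C.IsLogicalX q.1) = C.distX ∧
  faultDistance c (fun q => C.IsLogicalZ q.2) = C.distZ ∧
  faultDistance c (fun q => C.HZ *ᵥ q.1 = 0 ∧ C.HX *ᵥ q.2 = 0 ∧
    (q.1 ∉ C.groupX ∨ q.2 ∉ C.groupZ)) = C.dist

/-- The standard implementation of a hypergraph product gadget: the left sector is permuted by
`σ₁ ⊗ σ₂`, while an arbitrary circuit `e` runs on the right sector. -/
def standardHGP {B₁ S₁ B₂ S₂ : Type*} [Fintype B₁] [Fintype S₁] [Fintype B₂] [Fintype S₂]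
    [DecidableEq B₁] [DecidableEq S₁] [DecidableEq B₂] [DecidableEq S₂]
    (σ₁ : Equiv.Perm B₁) (σ₂ : Equiv.Perm B₂) (e : Circuit (S₁ × S₂)) :
    Circuit ((B₁ × B₂) ⊕ (S₁ × S₂)) :=
  sum [Layer.permute (Equiv.prodCongr σ₁ σ₂)] e

/-- The inherited implementation of `(U ⊗ 1) ⊕ (W ⊗ 1)`: the input circuit `c` runs in parallel in
all columns of the left sector, while the circuit `d` runs on the right sector. -/
def inheritedQ {rX B S : Type*} [Fintype rX] [Fintype B] [Fintype S]
    [DecidableEq rX] [DecidableEq B] [DecidableEq S]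
    (c : Circuit ι) (d : Circuit (rX × S)) : Circuit ((ι × B) ⊕ (rX × S)) :=
  sum (parallel B c) d

/-- The inherited implementation of `(1 ⊗ σ) ⊕ (1 ⊗ w⁻ᵀ)`: the left sector is permuted by `1 ⊗ σ`,
while the circuit `e` runs on the right sector. -/
def inheritedC {rX B S : Type*} [Fintype rX] [Fintype B] [Fintype S]
    [DecidableEq rX] [DecidableEq B] [DecidableEq S]
    (ι : Type*) [Fintype ι] [DecidableEq ι]
    (σ : Equiv.Perm B) (e : Circuit (rX × S)) : Circuit ((ι × B) ⊕ (rX × S)) :=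
  sum [Layer.permute (Equiv.prodCongr (Equiv.refl ι) σ)] e

end Circuit

end Circuits

end QGadget

/-!
An error pattern of a circuit is summarized by the relation `Circuit.Reach c q N`: the outgoing
error `q` can be produced with at most `N` elementary faults.  Reachability is linear
(`Reach.add`), contains every error `e` at the cost of its weight (`reach_card_supp`), and passes to
circuits that run side by side without interacting: to the left sector (`Reach.left`) and to the
columns of a parallel execution, the costs of the columns adding up to at most `N`
(`Reach.column`).  Because every error costs at most its weight, the fault distances never exceed
the code distances; what has to be shown is that they are not smaller
(`distancePreserving_of_le`).

The bounds come from the structure of the left-sector product of a CSS subsystem code `C` with a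
classical check matrix `h`.  The left sector is regarded as a matrix `M` whose columns are operators
of `C`.

* If `(M | N)` is a nontrivial logical `X` operator, some linear functional that kills the `X` gauge
  group of `C` does not kill all columns; its values on the columns form a nonzero codeword `v` of
  `h`, and all columns in the support of `v` are nontrivial logical for `C`
  (`exists_mem_ker_of_isLogicalX`).  Conversely `x ⊗ v` is logical if `x` is.  So the `X` distance of
  the product is at most the sum of what one pays in the single columns
  (`leftProduct_distX_le_sum`).
* If `(M | N)` is a nontrivial logical `Z` operator, some codeword `c` of `h` makes `M c` a nontrivial
  logical `Z` operator of `C` (`exists_mem_ker_of_isLogicalZ`), and the `Z` distance of the product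
  is at most that of `C`.  By linearity, superposing the columns in the support of `c` yields faults
  of the input circuit that produce `M c`.

Together these give the theorem for a gadget inherited from the quantum input
(`DistancePreserving.inheritedQ`).  They also show that the left part alone of a nontrivial logical
operator has at least the weight of the distance.  If the left sector is only permuted, the left
part of the outgoing error has at most as many nontrivial qubits as there were faults, whatever
happens on the right (`distancePreserving_sum_permute`).  The hypergraph product code is the product
of a classical code without `Z` checks with another classical code, so that the same statements
cover it.
-/

set_option linter.unusedSectionVars false

namespace QGadget

/-! ### Pauli operators and layers -/

variable {ι κ : Type*} [Fintype ι] [DecidableEq ι] [Fintype κ] [DecidableEq κ]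

namespace Pauli

/-- Relabelling of a Pauli operator along a map of qubits; for an injective map, its restriction to
a part of the qubits. -/
def comap (g : κ → ι) (p : Pauli ι) : Pauli κ := (p.1 ∘ g, p.2 ∘ g)

theorem mem_supp {p : Pauli ι} {i : ι} : i ∈ Pauli.supp p ↔ p.1 i ≠ 0 ∨ p.2 i ≠ 0 := by
  simp [Pauli.supp]

theorem mem_supp_comap {g : κ → ι} {p : Pauli ι} {k : κ} :
    k ∈ Pauli.supp (Pauli.comap g p) ↔ g k ∈ Pauli.supp p := by
  simp [mem_supp, Pauli.comap]

theorem supp_zero : Pauli.supp (0 : Pauli ι) = ∅ := by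
  ext; simp [mem_supp]

theorem supp_add (p q : Pauli ι) : Pauli.supp (p + q) ⊆ Pauli.supp p ∪ Pauli.supp q := by
  intro i
  simp only [Finset.mem_union, mem_supp, Prod.fst_add, Prod.snd_add, Pi.add_apply]
  contrapose!
  rintro ⟨⟨h1, h2⟩, h3, h4⟩
  simp [h1, h2, h3, h4]

theorem card_supp_add (p q : Pauli ι) :
    (Pauli.supp (p + q)).card ≤ (Pauli.supp p).card + (Pauli.supp q).card :=
  (Finset.card_le_card (supp_add p q)).trans (Finset.card_union_le _ _)

theorem add_self (p : Pauli ι) : p + p = 0 := by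
  ext i <;> exact CharTwo.add_self_eq_zero _

theorem hammingNorm_fst_le (p : Pauli ι) : hammingNorm p.1 ≤ (Pauli.supp p).card :=
  Finset.card_le_card fun i hi => mem_supp.2 <| Or.inl (by simpa using hi)

theorem hammingNorm_snd_le (p : Pauli ι) : hammingNorm p.2 ≤ (Pauli.supp p).card :=
  Finset.card_le_card fun i hi => mem_supp.2 <| Or.inr (by simpa using hi)

end Pauli

namespace Layer

theorem act_zero (l : Layer ι) : l.act 0 = 0 := by
  have : ((0 : ι → F2) ∘ l.perm.symm) = 0 := rfl
  simp [act, this]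

theorem act_add (l : Layer ι) (p q : Pauli ι) : l.act (p + q) = l.act p + l.act q := by
  simp [act, Pi.add_comp, add_vecMul]

theorem faults_zero (l : Layer ι) : l.faults 0 = 0 := by
  simp [faults, Pauli.supp_zero]

theorem faults_add (l : Layer ι) (f g : Pauli ι) : l.faults (f + g) ≤ l.faults f + l.faults g := by
  refine (Finset.card_le_card (Finset.image_subset_image (Pauli.supp_add f g))).trans ?_
  rw [Finset.image_union]
  exact Finset.card_union_le _ _

theorem faults_le (l : Layer ι) (f : Pauli ι) : l.faults f ≤ (Pauli.supp f).card :=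
  Finset.card_image_le

theorem faults_permute (π : Equiv.Perm ι) (f : Pauli ι) :
    (permute π).faults f = (Pauli.supp f).card := by
  simp [faults, permute]

theorem act_permute (π : Equiv.Perm ι) (p : Pauli ι) :
    (permute π).act p = Pauli.comap π.symm p := by
  simp [act, permute, Pauli.comap]

theorem comap_act_sum (l : Layer ι) (l' : Layer κ) (p : Pauli (ι ⊕ κ)) :
    Pauli.comap Sum.inl ((l.sum l').act p) = l.act (Pauli.comap Sum.inl p) := by
  have hg : ((l.sum l').gate⁻¹).val = fromBlocks (l.gate⁻¹).val 0 0 (l'.gate⁻¹).val := rfl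
  simp only [Pauli.comap, act, hg, fromBlocks_transpose, transpose_zero]
  simp only [sum, vecMul_fromBlocks, Sum.elim_comp_inl, vecMul_zero, add_zero]
  rfl

theorem faults_comap_inl_le (l : Layer ι) (l' : Layer κ) (f : Pauli (ι ⊕ κ)) :
    l.faults (Pauli.comap Sum.inl f) ≤ (l.sum l').faults f := by
  refine Finset.card_le_card_of_injOn Sum.inl ?_ Sum.inl_injective.injOn
  intro a ha
  simp only [Finset.coe_image, Set.mem_image, Finset.mem_coe] at ha ⊢
  obtain ⟨i, hi, rfl⟩ := ha
  exact ⟨Sum.inl i, Pauli.mem_supp_comap.1 hi, rfl⟩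

theorem vecMul_kronecker_one (x : ι × κ → F2) (A : Matrix ι ι F2) (k : κ) :
    (fun i => (x ᵥ* (A ⊗ₖ (1 : Matrix κ κ F2))) (i, k)) = (fun i => x (i, k)) ᵥ* A := by
  ext i
  simp [vecMul, dotProduct, Fintype.sum_prod_type, kroneckerMap_apply, one_apply]

theorem comap_act_parallel (l : Layer ι) (p : Pauli (ι × κ)) (k : κ) :
    Pauli.comap (fun i => (i, k)) ((l.parallel κ).act p)
      = l.act (Pauli.comap (fun i => (i, k)) p) := by
  have hg : ((l.parallel κ).gate⁻¹).val = (l.gate⁻¹).val ⊗ₖ (1 : Matrix κ κ F2) := rfl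
  simp only [act, hg, ← kroneckerMap_transpose, transpose_one]
  exact Prod.ext (vecMul_kronecker_one _ _ k) (vecMul_kronecker_one _ _ k)

/-- Copies of a layer in different columns share no location, so the fault counts add up exactly. -/
theorem sum_faults_comap (l : Layer ι) (f : Pauli (ι × κ)) :
    ∑ k, l.faults (Pauli.comap (fun i => (i, k)) f) = (l.parallel κ).faults f := by
  rw [faults, Finset.card_eq_sum_card_fiberwise (f := Prod.snd) (t := Finset.univ)
    (fun _ _ => by simp)]
  refine Finset.sum_congr rfl fun k _ => ?_
  refine Finset.card_nbij' (fun a => (a, k)) Prod.fst ?_ ?_ (fun _ _ => rfl) ?_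
  · intro a ha
    simp only [Finset.coe_image, Set.mem_image, Finset.mem_coe] at ha
    obtain ⟨i, hi, rfl⟩ := ha
    have h : (i, k) ∈ Pauli.supp f := Pauli.mem_supp_comap (g := fun i => (i, k)).1 hi
    simpa [parallel] using ⟨i, h, rfl⟩
  · rintro ⟨a, k'⟩ ha
    simp only [Finset.coe_filter, Finset.mem_image, Set.mem_ofPred_eq] at ha
    obtain ⟨⟨⟨i, k''⟩, hi, h⟩, rfl⟩ := ha
    simp only [parallel, Prod.map, id, Prod.mk.injEq] at h
    obtain ⟨rfl, rfl⟩ := h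
    have h : i ∈ Pauli.supp (Pauli.comap (fun i => (i, k'')) f) := Pauli.mem_supp_comap.2 hi
    simpa using ⟨i, h, rfl⟩
  · rintro ⟨a, k'⟩ ha
    simp only [Finset.coe_filter, Set.mem_ofPred_eq] at ha
    simp [ha.2]

theorem mat_sum (l : Layer ι) (l' : Layer κ) :
    (l.sum l').mat = fromBlocks l.mat 0 0 l'.mat := by
  have : (Equiv.Perm.permMatrix F2 (Equiv.sumCongr l.perm l'.perm)) =
      fromBlocks (l.perm.permMatrix F2) 0 0 (l'.perm.permMatrix F2) := by
    ext (i | i) (j | j) <;> simp [Equiv.Perm.permMatrix, PEquiv.toMatrix_apply]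
  simp [mat, sum, this, fromBlocks_multiply]

end Layer

theorem permMatrix_prodCongr (σ : Equiv.Perm ι) (τ : Equiv.Perm κ) :
    Equiv.Perm.permMatrix F2 (Equiv.prodCongr σ τ) = σ.permMatrix F2 ⊗ₖ τ.permMatrix F2 := by
  ext ⟨i, k⟩ ⟨j, k'⟩
  simp only [Equiv.Perm.permMatrix, PEquiv.toMatrix_apply, kroneckerMap_apply]
  by_cases h : σ i = j <;> by_cases h' : τ k = k' <;> simp [h, h']

namespace Layer

theorem mat_parallel (l : Layer ι) : (l.parallel κ).mat = l.mat ⊗ₖ (1 : Matrix κ κ F2) := by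
  have h : (l.parallel κ).perm = Equiv.prodCongr l.perm (Equiv.refl κ) := rfl
  have h' : Equiv.Perm.permMatrix F2 (Equiv.refl κ) = 1 := permMatrix_one
  rw [mat, h, permMatrix_prodCongr, h']
  simp [mat, parallel, ← mul_kronecker_mul]

theorem mat_permute (π : Equiv.Perm ι) : (permute π).mat = π.permMatrix F2 := by
  simp [mat, permute]

end Layer

/-! ### Producing errors with a given number of faults -/

namespace Circuit

theorem mat_nil : mat ([] : Circuit ι) = 1 := rfl

theorem mat_cons (l : Layer ι) (c : Circuit ι) : mat (l :: c) = l.mat * mat c := by simp [mat]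

theorem mat_sum : ∀ (c : Circuit ι) (d : Circuit κ), (sum c d).mat = fromBlocks c.mat 0 0 d.mat
  | [], [] => by simp [sum, mat_nil]
  | l :: c, [] => by
    simp [sum, mat_cons, mat_sum c [], Layer.mat_sum, fromBlocks_multiply, Layer.idle,
      Layer.mat_permute, mat_nil]
  | [], l' :: d => by
    simp [sum, mat_cons, mat_sum [] d, Layer.mat_sum, fromBlocks_multiply, Layer.idle,
      Layer.mat_permute, mat_nil]
  | l :: c, l' :: d => by
    simp [sum, mat_cons, mat_sum c d, Layer.mat_sum, fromBlocks_multiply]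

theorem mat_parallel : ∀ c : Circuit ι, (parallel κ c).mat = c.mat ⊗ₖ (1 : Matrix κ κ F2)
  | [] => by simp [parallel, mat_nil]
  | l :: c => by
    have := mat_parallel c
    simp only [parallel, List.map_cons, mat_cons, Layer.mat_parallel] at this ⊢
    rw [this, ← mul_kronecker_mul, Matrix.mul_one]

/-- The circuit `c` can produce the outgoing error `q` with at most `N` elementary faults, faults on
the qubits before the first layer included. -/
def Reach (c : Circuit ι) (q : Pauli ι) (N : ℕ) : Prop :=
  ∃ p n, Run c p q n ∧ (Pauli.supp p).card + n ≤ N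

theorem run_nil_iff {p q : Pauli ι} {n : ℕ} : Run [] p q n ↔ q = p ∧ n = 0 := by
  constructor
  · rintro ⟨⟩; exact ⟨rfl, rfl⟩
  · rintro ⟨rfl, rfl⟩; exact .nil _

theorem run_cons_iff {l : Layer ι} {c : Circuit ι} {p q : Pauli ι} {n : ℕ} :
    Run (l :: c) p q n ↔ ∃ f m, Run c (l.act p + f) q m ∧ n = l.faults f + m := by
  constructor
  · rintro ⟨⟩; exact ⟨_, _, ‹_›, rfl⟩
  · rintro ⟨f, m, h, rfl⟩; exact .cons _ _ _ _ _ _ h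

theorem run_zero : ∀ c : Circuit ι, Run c 0 0 0
  | [] => .nil 0
  | l :: c => run_cons_iff.2 ⟨0, 0, by simpa [Layer.act_zero] using run_zero c,
      by simp [Layer.faults_zero]⟩

/-- Superposing two noisy runs takes no more faults than the two runs together: the layers act
linearly, and an error on a location is arbitrary. -/
theorem Run.add {c : Circuit ι} {p q p' q' : Pauli ι} {n n' : ℕ} (h : Run c p q n)
    (h' : Run c p' q' n') : ∃ m ≤ n + n', Run c (p + p') (q + q') m := by
  induction c generalizing p p' n n' with
  | nil =>
    obtain ⟨rfl, rfl⟩ := run_nil_iff.1 h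
    obtain ⟨rfl, rfl⟩ := run_nil_iff.1 h'
    exact ⟨0, le_rfl, .nil _⟩
  | cons l c ih =>
    obtain ⟨f, m, hf, rfl⟩ := run_cons_iff.1 h
    obtain ⟨f', m', hf', rfl⟩ := run_cons_iff.1 h'
    obtain ⟨k, hk, hr⟩ := ih hf hf'
    refine ⟨l.faults (f + f') + k, ?_, run_cons_iff.2 ⟨f + f', k, ?_, rfl⟩⟩
    · have := l.faults_add f f'
      omega
    · rwa [Layer.act_add, add_add_add_comm]

/-- All faults may be put into the last layer. -/
theorem run_last : ∀ c : Circuit ι, c ≠ [] → ∀ e : Pauli ι,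
    ∃ n ≤ (Pauli.supp e).card, Run c 0 e n
  | [], h, _ => absurd rfl h
  | [l], _, e => ⟨l.faults e + 0, l.faults_le e,
      run_cons_iff.2 ⟨e, 0, by simpa [Layer.act_zero] using Run.nil e, rfl⟩⟩
  | l :: l' :: c, _, e => by
    obtain ⟨n, hn, h⟩ := run_last (l' :: c) (by simp) e
    exact ⟨n, hn, run_cons_iff.2 ⟨0, n, by simpa [Layer.act_zero] using h,
      by simp [Layer.faults_zero]⟩⟩

theorem reach_card_supp (c : Circuit ι) (e : Pauli ι) : Reach c e (Pauli.supp e).card := by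
  rcases eq_or_ne c [] with rfl | hc
  · exact ⟨e, 0, .nil e, le_rfl⟩
  · obtain ⟨n, hn, h⟩ := run_last c hc e
    exact ⟨0, n, h, by simpa [Pauli.supp_zero] using hn⟩

theorem Reach.mono {c : Circuit ι} {q : Pauli ι} {N M : ℕ} (h : Reach c q N) (hNM : N ≤ M) :
    Reach c q M := by
  obtain ⟨p, n, h, hn⟩ := h
  exact ⟨p, n, h, hn.trans hNM⟩

theorem reach_zero (c : Circuit ι) : Reach c 0 0 := ⟨0, 0, run_zero c, by simp [Pauli.supp_zero]⟩

theorem Reach.add {c : Circuit ι} {q q' : Pauli ι} {N N' : ℕ} (h : Reach c q N)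
    (h' : Reach c q' N') : Reach c (q + q') (N + N') := by
  obtain ⟨p, n, h, hn⟩ := h
  obtain ⟨p', n', h', hn'⟩ := h'
  obtain ⟨m, hm, hr⟩ := h.add h'
  have := Pauli.card_supp_add p p'
  exact ⟨_, m, hr, by omega⟩

theorem Reach.sum {c : Circuit ι} {α : Type*} (s : Finset α) {q : α → Pauli ι} {N : α → ℕ}
    (h : ∀ a ∈ s, Reach c (q a) (N a)) : Reach c (∑ a ∈ s, q a) (∑ a ∈ s, N a) := by
  classical
  induction s using Finset.induction_on with
  | empty => simpa using reach_zero c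
  | insert a s ha ih =>
    rw [Finset.sum_insert ha, Finset.sum_insert ha]
    exact (h a (by simp)).add (ih fun b hb => h b (by simp [hb]))

/-- The left part of a run of two circuits side by side is a run of the left circuit, up to the error
`e` that occurs while the left circuit is padded with idling; `e` costs its weight since idling
qubits are locations of their own. -/
theorem run_sum_left : ∀ (c : Circuit ι) (d : Circuit κ) {p q : Pauli (ι ⊕ κ)} {n : ℕ},
    Run (Circuit.sum c d) p q n → ∃ e m, Run c (Pauli.comap Sum.inl p) (Pauli.comap Sum.inl q + e) m ∧
      m + (Pauli.supp e).card ≤ n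
  | [], [], p, q, n, h => by
    obtain ⟨rfl, rfl⟩ := run_nil_iff.1 (by simpa [Circuit.sum] using h)
    exact ⟨0, 0, by simpa using Run.nil _, by simp [Pauli.supp_zero]⟩
  | l :: c, [], p, q, n, h => by
    rw [Circuit.sum] at h
    obtain ⟨f, m, hrun, rfl⟩ := run_cons_iff.1 h
    obtain ⟨e, k, hr, hk⟩ := run_sum_left c [] hrun
    have hf := l.faults_comap_inl_le (Layer.idle κ) f
    refine ⟨e, _, run_cons_iff.2 ⟨Pauli.comap Sum.inl f, k, ?_, rfl⟩, by omega⟩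
    rwa [← Layer.comap_act_sum l (Layer.idle κ)]
  | [], l' :: d, p, q, n, h => by
    rw [Circuit.sum] at h
    obtain ⟨f, m, hrun, rfl⟩ := run_cons_iff.1 h
    obtain ⟨e, k, hr, hk⟩ := run_sum_left [] d hrun
    have hf := (Layer.idle ι).faults_comap_inl_le l' f
    rw [Layer.idle, Layer.faults_permute] at hf
    have hs := Pauli.card_supp_add e (Pauli.comap Sum.inl f)
    obtain ⟨he, rfl⟩ := run_nil_iff.1 hr
    refine ⟨e + Pauli.comap Sum.inl f, 0, run_nil_iff.2 ⟨?_, rfl⟩, by rw [Layer.idle]; omega⟩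
    have ha : Pauli.comap Sum.inl (((Layer.idle ι).sum l').act p + f)
        = Pauli.comap Sum.inl p + Pauli.comap Sum.inl f := by
      change Pauli.comap Sum.inl (((Layer.idle ι).sum l').act p) + Pauli.comap Sum.inl f = _
      rw [Layer.comap_act_sum, Layer.idle, Layer.act_permute]
      rfl
    rw [← add_assoc, he, ha, add_assoc, Pauli.add_self, add_zero]
  | l :: c, l' :: d, p, q, n, h => by
    rw [Circuit.sum] at h
    obtain ⟨f, m, hrun, rfl⟩ := run_cons_iff.1 h
    obtain ⟨e, k, hr, hk⟩ := run_sum_left c d hrun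
    have hf := l.faults_comap_inl_le l' f
    refine ⟨e, _, run_cons_iff.2 ⟨Pauli.comap Sum.inl f, k, ?_, rfl⟩, by omega⟩
    rwa [← Layer.comap_act_sum l l']

theorem Reach.left {c : Circuit ι} {d : Circuit κ} {q : Pauli (ι ⊕ κ)} {N : ℕ}
    (h : Reach (Circuit.sum c d) q N) : Reach c (Pauli.comap Sum.inl q) N := by
  obtain ⟨p, n, h, hn⟩ := h
  obtain ⟨e, m, hr, hm⟩ := run_sum_left c d h
  have hp : (Pauli.supp (Pauli.comap Sum.inl p)).card ≤ (Pauli.supp p).card :=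
    Finset.card_le_card_of_injOn Sum.inl (fun i hi => Pauli.mem_supp_comap.1 hi)
      Sum.inl_injective.injOn
  -- errors during the padding can be made to happen within `c` itself
  have h' := Reach.add ⟨_, m, hr, le_rfl⟩ (reach_card_supp c e)
  rw [add_assoc, Pauli.add_self, add_zero] at h'
  exact h'.mono (by omega)

theorem run_parallel_column (c : Circuit ι) {p q : Pauli (ι × κ)} {n : ℕ}
    (h : Run (parallel κ c) p q n) : ∃ m : κ → ℕ, ∑ k, m k = n ∧
      ∀ k, Run c (Pauli.comap (fun i => (i, k)) p) (Pauli.comap (fun i => (i, k)) q) (m k) := by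
  induction c generalizing p n with
  | nil =>
    obtain ⟨rfl, rfl⟩ := run_nil_iff.1 h
    exact ⟨0, by simp, fun k => .nil _⟩
  | cons l c ih =>
    obtain ⟨f, m, hrun, rfl⟩ := run_cons_iff.1 h
    obtain ⟨m, rfl, hm⟩ := ih hrun
    refine ⟨fun k => l.faults (Pauli.comap (fun i => (i, k)) f) + m k, ?_, fun k =>
      run_cons_iff.2 ⟨_, _, ?_, rfl⟩⟩
    · rw [Finset.sum_add_distrib, Layer.sum_faults_comap]
    · rw [← Layer.comap_act_parallel]
      exact hm k

theorem sum_card_supp_column (p : Pauli (ι × κ)) :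
    ∑ k, (Pauli.supp (Pauli.comap (fun i => (i, k)) p)).card = (Pauli.supp p).card := by
  -- the layer `permute 1` counts each qubit as a location
  simpa [Layer.faults, Layer.parallel, Layer.permute] using
    Layer.sum_faults_comap (Layer.permute 1) p

theorem Reach.column {c : Circuit ι} {q : Pauli (ι × κ)} {N : ℕ}
    (h : Reach (parallel κ c) q N) : ∃ M : κ → ℕ, ∑ k, M k ≤ N ∧
      ∀ k, Reach c (Pauli.comap (fun i => (i, k)) q) (M k) := by
  obtain ⟨p, n, h, hn⟩ := h
  obtain ⟨m, rfl, hm⟩ := run_parallel_column c h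
  refine ⟨_, ?_, fun k => ⟨_, _, hm k, le_rfl⟩⟩
  rwa [Finset.sum_add_distrib, sum_card_supp_column]

theorem Reach.card_supp_le_of_permute {π : Equiv.Perm ι} {q : Pauli ι} {N : ℕ}
    (h : Reach [Layer.permute π] q N) : (Pauli.supp q).card ≤ N := by
  obtain ⟨p, n, h, hn⟩ := h
  obtain ⟨f, m, hrun, rfl⟩ := run_cons_iff.1 h
  obtain ⟨rfl, rfl⟩ := run_nil_iff.1 hrun
  rw [Layer.faults_permute] at hn
  have hp : (Pauli.supp ((Layer.permute π).act p)).card ≤ (Pauli.supp p).card := by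
    rw [Layer.act_permute]
    exact Finset.card_le_card_of_injOn π.symm (fun i hi => Pauli.mem_supp_comap.1 hi)
      π.symm.injective.injOn
  have := Pauli.card_supp_add ((Layer.permute π).act p) f
  omega

theorem faultDistance_le {c : Circuit ι} {P : Pauli ι → Prop} {q : Pauli ι} {N : ℕ}
    (h : Reach c q N) (hq : P q) : faultDistance c P ≤ N := by
  obtain ⟨p, n, h, hn⟩ := h
  exact le_trans (b := ((_ : ℕ) : ℕ∞)) (sInf_le ⟨p, q, n, h, hq, rfl⟩) (by exact_mod_cast hn)

theorem le_faultDistance {c : Circuit ι} {P : Pauli ι → Prop} {D : ℕ∞}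
    (h : ∀ q N, Reach c q N → P q → D ≤ N) : D ≤ faultDistance c P := by
  refine le_sInf ?_
  rintro _ ⟨p, q, n, hr, hq, rfl⟩
  exact h q _ ⟨p, n, hr, le_rfl⟩ hq

end Circuit

/-! ### Linear algebra over the binary field -/

theorem F2_add_eq_zero {m n : Type*} {A A' : Matrix m n F2} : A + A' = 0 ↔ A = A' := by
  simp only [← Matrix.ext_iff, Matrix.add_apply, Matrix.zero_apply, CharTwo.add_eq_zero]

/-- With `g`, the matrix `1 - g * A` is a projection onto the kernel of `A`. -/
theorem exists_generalized_inverse {m n : Type*} [Fintype m] [Fintype n] [DecidableEq m]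
    [DecidableEq n] (A : Matrix m n F2) : ∃ g : Matrix n m F2, A * g * A = A := by
  obtain ⟨s, hs⟩ := A.toLin'.rangeRestrict.exists_rightInverse_of_surjective
    A.toLin'.range_rangeRestrict
  obtain ⟨g, hg⟩ := s.exists_extend
  refine ⟨LinearMap.toMatrix' g, Matrix.toLin'.injective (LinearMap.ext fun v => ?_)⟩
  have h1 : g (A.toLin' v) = s (A.toLin'.rangeRestrict v) :=
    LinearMap.congr_fun hg (A.toLin'.rangeRestrict v)
  have h2 := congrArg Subtype.val (LinearMap.congr_fun hs (A.toLin'.rangeRestrict v))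
  rw [Matrix.toLin'_mul, Matrix.toLin'_mul, Matrix.toLin'_toMatrix', LinearMap.comp_apply,
    LinearMap.comp_apply, h1]
  exact h2

theorem mem_span_row_iff {m n : Type*} [Fintype m] (A : Matrix m n F2) (v : n → F2) :
    v ∈ Submodule.span F2 (Set.range A.row) ↔ ∃ y, y ᵥ* A = v := by
  rw [← range_vecMulLinear]
  simp

/-! ### Subsystem codes -/

namespace SubsystemCode

variable {rX rZ ι : Type*} [Fintype rX] [Fintype rZ] [Fintype ι]

theorem mem_groupX {C : SubsystemCode rX rZ ι} {v : ι → F2} :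
    v ∈ C.groupX ↔ ∃ y, ∃ g ∈ C.gaugeX, y ᵥ* C.HX + g = v := by
  simp [groupX, Submodule.mem_sup, mem_span_row_iff]

theorem mem_groupZ {C : SubsystemCode rX rZ ι} {v : ι → F2} :
    v ∈ C.groupZ ↔ ∃ y, ∃ g ∈ C.gaugeZ, y ᵥ* C.HZ + g = v := by
  simp [groupZ, Submodule.mem_sup, mem_span_row_iff]

theorem exists_matrix_groupX {C : SubsystemCode rX rZ ι} {B : Type*} {M : Matrix ι B F2}
    (h : ∀ j, M.col j ∈ C.groupX) :
    ∃ (Y : Matrix rX B F2) (Γ : Matrix ι B F2), (∀ j, Γ.col j ∈ C.gaugeX) ∧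
      M = C.HXᵀ * Y + Γ := by
  choose y γ hγ hy using fun j => mem_groupX.1 (h j)
  refine ⟨of fun r j => y j r, of fun i j => γ j i, hγ, ?_⟩
  ext i j
  have := congrFun (hy j) i
  simpa [vecMul, dotProduct, mul_apply, mul_comm] using this.symm

theorem exists_matrix_groupZ {C : SubsystemCode rX rZ ι} {B : Type*} {M : Matrix ι B F2}
    (h : ∀ j, M.col j ∈ C.groupZ) :
    ∃ (Y : Matrix rZ B F2) (Γ : Matrix ι B F2), (∀ j, Γ.col j ∈ C.gaugeZ) ∧
      M = C.HZᵀ * Y + Γ := by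
  choose y γ hγ hy using fun j => mem_groupZ.1 (h j)
  refine ⟨of fun r j => y j r, of fun i j => γ j i, hγ, ?_⟩
  ext i j
  have := congrFun (hy j) i
  simpa [vecMul, dotProduct, mul_apply, mul_comm] using this.symm

theorem HX_mulVec_of_mem_groupZ {C : SubsystemCode rX rZ ι} {z : ι → F2} (hz : z ∈ C.groupZ) :
    C.HX *ᵥ z = 0 := by
  obtain ⟨y, g, hg, rfl⟩ := mem_groupZ.1 hz
  rw [mulVec_add, C.gaugeZ_comm g hg, ← mulVec_transpose, mulVec_mulVec, C.comm, zero_mulVec,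
    add_zero]

theorem distX_le {C : SubsystemCode rX rZ ι} {x : ι → F2} (hx : C.IsLogicalX x) :
    C.distX ≤ hammingNorm x := sInf_le ⟨x, hx, rfl⟩

theorem distZ_le {C : SubsystemCode rX rZ ι} {z : ι → F2} (hz : C.IsLogicalZ z) :
    C.distZ ≤ hammingNorm z := sInf_le ⟨z, hz, rfl⟩

theorem exists_hammingNorm_eq_distX {C : SubsystemCode rX rZ ι} {x : ι → F2}
    (hx : C.IsLogicalX x) : ∃ y, C.IsLogicalX y ∧ C.distX = hammingNorm y :=
  csInf_mem (s := {n : ℕ∞ | ∃ x, C.IsLogicalX x ∧ n = (hammingNorm x : ℕ)}) ⟨_, x, hx, rfl⟩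

theorem exists_hammingNorm_eq_distZ {C : SubsystemCode rX rZ ι} {z : ι → F2}
    (hz : C.IsLogicalZ z) : ∃ y, C.IsLogicalZ y ∧ C.distZ = hammingNorm y :=
  csInf_mem (s := {n : ℕ∞ | ∃ x, C.IsLogicalZ x ∧ n = (hammingNorm x : ℕ)}) ⟨_, z, hz, rfl⟩

end SubsystemCode

/-! ### Logical operators of left-sector products -/

section Product

variable {rX rZ ι B S : Type*}

/-- The operator on the qubits `(ι × B) ⊕ (rX × S)` with left part `M` and right part `N`.
`Matrix.vec` puts the column index first, whence the transposes. -/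
def sectors (M : Matrix ι B F2) (N : Matrix rX S F2) : (ι × B) ⊕ (rX × S) → F2 :=
  Sum.elim (vec Mᵀ) (vec Nᵀ)

theorem exists_sectors (x : (ι × B) ⊕ (rX × S) → F2) :
    ∃ M N, sectors M N = x :=
  ⟨of fun i j => x (.inl (i, j)), of fun i j => x (.inr (i, j)), by ext (_ | _) <;> rfl⟩

theorem sectors_add (M M' : Matrix ι B F2) (N N' : Matrix rX S F2) :
    sectors (M + M') (N + N') = sectors M N + sectors M' N' := by
  ext (_ | _) <;> rfl

variable [Fintype rX] [Fintype rZ] [Fintype ι] [Fintype B] [Fintype S]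

theorem sectors_mul_transpose_left {k : Type*} [Fintype k] (A : Matrix ι k F2) (A' : Matrix B k F2) :
    sectors (A * A'ᵀ) (0 : Matrix rX S F2) = ∑ j, inL (tens (A.col j) (A'.col j)) := by
  ext (p | p)
  · simp [sectors, inL, tens, mul_apply, Finset.sum_apply, vec, mul_comm]
  · simp [sectors, inL, Finset.sum_apply]

theorem sectors_mul_transpose_right {k : Type*} [Fintype k] (A : Matrix rX k F2)
    (A' : Matrix S k F2) :
    sectors (0 : Matrix ι B F2) (A * A'ᵀ) = ∑ j, inR (tens (A.col j) (A'.col j)) := by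
  ext (p | p)
  · simp [sectors, inR, Finset.sum_apply]
  · simp [sectors, inR, tens, mul_apply, Finset.sum_apply, vec, mul_comm]

variable [DecidableEq rX] [DecidableEq ι] [DecidableEq B] [DecidableEq S]

theorem prodX_mulVec_sectors (HX : Matrix rX ι F2) (h : Matrix S B F2) (M : Matrix ι B F2)
    (N : Matrix rX S F2) : prodX HX h *ᵥ sectors M N = 0 ↔ HX * M = N * h := by
  rw [prodX, fromCols_mulVec, sectors, Sum.elim_comp_inl, Sum.elim_comp_inr, kronecker_mulVec_vec,
    kronecker_mulVec_vec, ← vec_add, vec_eq_zero_iff, ← transpose_eq_zero]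
  simp [F2_add_eq_zero]

theorem prodZ_mulVec_sectors (HX : Matrix rX ι F2) (HZ : Matrix rZ ι F2) (h : Matrix S B F2)
    (M : Matrix ι B F2) (N : Matrix rX S F2) :
    prodZ HX HZ h *ᵥ sectors M N = 0 ↔ HZ * M = 0 ∧ M * hᵀ = HXᵀ * N := by
  rw [prodZ, fromBlocks_mulVec, sectors, Sum.elim_comp_inl, Sum.elim_comp_inr, zero_mulVec,
    add_zero, kronecker_mulVec_vec, kronecker_mulVec_vec, kronecker_mulVec_vec, ← vec_add,
    ← Sum.elim_zero_zero, Sum.elim_eq_iff, vec_eq_zero_iff, vec_eq_zero_iff, ← transpose_eq_zero,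
    ← transpose_eq_zero (M := _ + _)]
  simp [F2_add_eq_zero]

theorem vecMul_prodX (HX : Matrix rX ι F2) (h : Matrix S B F2) (Y : Matrix rX B F2) :
    vec Yᵀ ᵥ* prodX HX h = sectors (HXᵀ * Y) (Y * hᵀ) := by
  rw [prodX, vecMul_fromCols]
  simp [sectors, vec_vecMul_kronecker]

theorem vecMul_prodZ (HX : Matrix rX ι F2) (HZ : Matrix rZ ι F2) (h : Matrix S B F2)
    (Y : Matrix rZ B F2) (Y' : Matrix ι S F2) :
    Sum.elim (vec Yᵀ) (vec Y'ᵀ) ᵥ* prodZ HX HZ h = sectors (HZᵀ * Y + Y' * h) (HX * Y') := by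
  rw [prodZ, vecMul_fromBlocks]
  simp [sectors, vec_vecMul_kronecker]


variable {C : SubsystemCode rX rZ ι} {h : Matrix S B F2} {M : Matrix ι B F2} {N : Matrix rX S F2}

theorem mul_row_mem_leftProduct_groupX (Y : Matrix rX B F2) :
    sectors (C.HXᵀ * Y) (Y * hᵀ) ∈ (leftProduct C h).groupX :=
  Submodule.mem_sup_left ((mem_span_row_iff _ _).2 ⟨_, vecMul_prodX C.HX h Y⟩)

theorem mul_row_mem_leftProduct_groupZ (Y : Matrix rZ B F2) (Y' : Matrix ι S F2) :
    sectors (C.HZᵀ * Y + Y' * h) (C.HX * Y') ∈ (leftProduct C h).groupZ :=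
  Submodule.mem_sup_left ((mem_span_row_iff _ _).2 ⟨_, vecMul_prodZ C.HX C.HZ h Y Y'⟩)

theorem left_mem_leftProduct_groupX {k : Type*} [Fintype k] {Γ : Matrix ι k F2}
    {P : Matrix B k F2} (hΓ : ∀ j, Γ.col j ∈ C.gaugeX) (hP : h * P = 0) :
    sectors (Γ * Pᵀ) 0 ∈ (leftProduct C h).groupX := by
  rw [sectors_mul_transpose_left]
  refine Submodule.mem_sup_right (Submodule.sum_mem _ fun j _ =>
    Submodule.subset_span (Or.inl ⟨_, hΓ j, _, ?_, rfl⟩))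
  ext s
  exact congrFun (congrFun hP s) j

theorem left_mem_leftProduct_groupZ {Γ : Matrix ι B F2} (hΓ : ∀ j, Γ.col j ∈ C.gaugeZ) :
    sectors Γ 0 ∈ (leftProduct C h).groupZ := by
  rw [← Matrix.mul_one Γ, ← transpose_one, sectors_mul_transpose_left]
  exact Submodule.mem_sup_right (Submodule.sum_mem _ fun j _ =>
    Submodule.subset_span (Or.inl ⟨_, hΓ j, _, rfl⟩))

theorem right_mem_leftProduct_groupX (hN : C.HXᵀ * N = 0) :
    sectors 0 N ∈ (leftProduct C h).groupX := by
  rw [← Matrix.mul_one N, ← transpose_one, sectors_mul_transpose_right]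
  refine Submodule.mem_sup_right (Submodule.sum_mem _ fun j _ =>
    Submodule.subset_span (Or.inr ⟨_, _, ?_, rfl⟩))
  ext s
  exact congrFun (congrFun hN s) j

theorem right_mem_leftProduct_groupZ (hN : N * h = 0) :
    sectors 0 N ∈ (leftProduct C h).groupZ := by
  rw [← Matrix.one_mul N, ← transpose_transpose N, sectors_mul_transpose_right]
  refine Submodule.mem_sup_right (Submodule.sum_mem _ fun j _ =>
    Submodule.subset_span (Or.inr ⟨_, _, ?_, rfl⟩))
  have hN' : hᵀ * Nᵀ = 0 := by rw [← transpose_mul, hN, transpose_zero]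
  ext s
  exact congrFun (congrFun hN' s) j

/-- A commuting `X` operator is trivial if all its columns are trivial in the factor `C`. -/
theorem mem_leftProduct_groupX_of_col (hMN : (leftProduct C h).HZ *ᵥ sectors M N = 0)
    (hM : ∀ j, M.col j ∈ C.groupX) : sectors M N ∈ (leftProduct C h).groupX := by
  obtain ⟨-, hMN⟩ := (prodZ_mulVec_sectors _ _ _ _ _).1 hMN
  obtain ⟨Y, Γ, hΓ, hY⟩ := C.exists_matrix_groupX hM
  obtain ⟨g, hg⟩ := exists_generalized_inverse h
  have hP : h * (1 - g * h) = 0 := by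
    rw [Matrix.mul_sub, ← Matrix.mul_assoc, hg, Matrix.mul_one, sub_self]
  -- `M = M (1 - g h)ᵀ + M hᵀ gᵀ`: the first part has codewords of `h` as rows, and the second one
  -- consists of `X` checks of `C` as `M hᵀ = H_Xᵀ N`
  have hL : C.HXᵀ * (Y * (1 - g * h)ᵀ + N * gᵀ) + Γ * (1 - g * h)ᵀ = M := by
    have : C.HXᵀ * Y = M - Γ := by rw [hY, add_sub_cancel_right]
    rw [Matrix.mul_add, ← Matrix.mul_assoc, ← Matrix.mul_assoc, ← hMN, this, Matrix.sub_mul,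
      transpose_sub, transpose_mul, transpose_one]
    simp only [Matrix.mul_sub, Matrix.mul_one, ← Matrix.mul_assoc]
    abel
  set Y' := Y * (1 - g * h)ᵀ + N * gᵀ
  have hR : C.HXᵀ * (N - Y' * hᵀ) = 0 := by
    have hΓ' : Γ * (1 - g * h)ᵀ * hᵀ = 0 := by
      rw [Matrix.mul_assoc, ← transpose_mul, hP, transpose_zero, Matrix.mul_zero]
    rw [Matrix.mul_sub, ← hMN, ← Matrix.mul_assoc, eq_sub_of_add_eq hL, Matrix.sub_mul, hΓ',
      sub_zero, sub_self]
  have key : sectors M N = sectors (C.HXᵀ * Y') (Y' * hᵀ) + sectors (Γ * (1 - g * h)ᵀ) 0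
      + sectors 0 (N - Y' * hᵀ) := by
    rw [← sectors_add, ← sectors_add, hL]
    congr 1 <;> abel
  rw [key]
  exact add_mem (add_mem (mul_row_mem_leftProduct_groupX _) (left_mem_leftProduct_groupX hΓ hP))
    (right_mem_leftProduct_groupX hR)

/-- A commuting `Z` operator is trivial if its contraction with each codeword of `h` is trivial in the
factor `C`. -/
theorem mem_leftProduct_groupZ_of_mulVec (hMN : (leftProduct C h).HX *ᵥ sectors M N = 0)
    (hM : ∀ c, h *ᵥ c = 0 → M *ᵥ c ∈ C.groupZ) : sectors M N ∈ (leftProduct C h).groupZ := by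
  replace hMN := (prodX_mulVec_sectors _ _ _ _).1 hMN
  obtain ⟨g, hg⟩ := exists_generalized_inverse h
  have hP : h * (1 - g * h) = 0 := by
    rw [Matrix.mul_sub, ← Matrix.mul_assoc, hg, Matrix.mul_one, sub_self]
  -- `M = M (1 - g h) + (M g) h`: the columns of the first part are contractions with codewords,
  -- and the second part comes from the checks `(1 ⊗ h | H_Xᵀ ⊗ 1)`
  have hMP : ∀ j, (M * (1 - g * h)).col j ∈ C.groupZ := fun j => by
    refine hM ((1 - g * h).col j) ?_
    ext s
    exact congrFun (congrFun hP s) j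
  obtain ⟨Y, Γ, hΓ, hY⟩ := C.exists_matrix_groupZ hMP
  have hR : (N - C.HX * (M * g)) * h = 0 := by
    have : C.HX * (M * (1 - g * h)) = 0 := by
      ext r j
      exact congrFun (C.HX_mulVec_of_mem_groupZ (hMP j)) r
    rw [Matrix.sub_mul, ← hMN, ← this]
    simp only [Matrix.mul_sub, Matrix.mul_one, Matrix.mul_assoc]
  have key : sectors M N = sectors (C.HZᵀ * Y + M * g * h) (C.HX * (M * g)) + sectors Γ 0
      + sectors 0 (N - C.HX * (M * g)) := by
    rw [← sectors_add, ← sectors_add, add_zero, add_right_comm, ← hY]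
    congr 1
    · rw [Matrix.mul_sub, Matrix.mul_one, Matrix.mul_assoc]; abel
    · abel
  rw [key]
  exact add_mem (add_mem (mul_row_mem_leftProduct_groupZ _ _) (left_mem_leftProduct_groupZ hΓ))
    (right_mem_leftProduct_groupZ hR)

theorem col_mem_groupX (j : B) {x : (ι × B) ⊕ (rX × S) → F2}
    (hx : x ∈ (leftProduct C h).groupX) : (fun i => x (.inl (i, j))) ∈ C.groupX := by
  suffices (leftProduct C h).groupX ≤ C.groupX.comap
      (LinearMap.funLeft F2 F2 fun i => (.inl (i, j) : (ι × B) ⊕ (rX × S))) from this hx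
  refine sup_le (Submodule.span_le.2 ?_) (Submodule.span_le.2 ?_)
  · rintro _ ⟨⟨r, b⟩, rfl⟩
    have : (LinearMap.funLeft F2 F2 fun i => (.inl (i, j) : (ι × B) ⊕ (rX × S)))
        ((leftProduct C h).HX.row (r, b)) = (1 : Matrix B B F2) b j • C.HX.row r := by
      ext i
      simp [leftProduct, prodX, LinearMap.funLeft_apply, kroneckerMap_apply, mul_comm]
    rw [SetLike.mem_coe, Submodule.mem_comap, this]
    exact Submodule.smul_mem _ _ (Submodule.mem_sup_left (Submodule.subset_span ⟨r, rfl⟩))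
  · rintro _ (⟨x, hx, c, -, rfl⟩ | ⟨a, b, -, rfl⟩)
    · have : (LinearMap.funLeft F2 F2 fun i => (.inl (i, j) : (ι × B) ⊕ (rX × S)))
          (inL (tens x c)) = c j • x := by
        ext i
        simp [LinearMap.funLeft_apply, inL, tens, mul_comm]
      rw [SetLike.mem_coe, Submodule.mem_comap, this]
      exact Submodule.smul_mem _ _ (Submodule.mem_sup_right hx)
    · exact zero_mem C.groupX

theorem sum_smul_col_mem_groupZ {c : B → F2} (hc : h *ᵥ c = 0) {z : (ι × B) ⊕ (rX × S) → F2}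
    (hz : z ∈ (leftProduct C h).groupZ) : ∑ j, c j • (fun i => z (.inl (i, j))) ∈ C.groupZ := by
  set f : ((ι × B) ⊕ (rX × S) → F2) →ₗ[F2] ι → F2 :=
    ∑ j, c j • LinearMap.funLeft F2 F2 fun i => (.inl (i, j) : (ι × B) ⊕ (rX × S)) with hf
  have hfz : ∀ z i, f z i = ∑ j, c j * z (.inl (i, j)) := by
    simp [hf, LinearMap.sum_apply, Finset.sum_apply, LinearMap.funLeft_apply]
  suffices (leftProduct C h).groupZ ≤ C.groupZ.comap f by
    have hz' : ∑ j, c j • (fun i => z (.inl (i, j))) = f z := by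
      ext i
      simp [hfz, Finset.sum_apply]
    rw [hz']
    exact this hz
  refine sup_le (Submodule.span_le.2 ?_) (Submodule.span_le.2 ?_)
  · rintro _ ⟨⟨r, b⟩ | ⟨i, s⟩, rfl⟩
    · have : f ((leftProduct C h).HZ.row (.inl (r, b))) = c b • C.HZ.row r := by
        ext i
        simp [hfz, leftProduct, prodZ, kroneckerMap_apply, one_apply]
      rw [SetLike.mem_coe, Submodule.mem_comap, this]
      exact Submodule.smul_mem _ _ (Submodule.mem_sup_left (Submodule.subset_span ⟨r, rfl⟩))
    · have : f ((leftProduct C h).HZ.row (.inr (i, s))) = 0 := by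
        ext i'
        have := congrFun hc s
        simp only [mulVec, dotProduct, Pi.zero_apply] at this
        have hrow : ∀ j, (leftProduct C h).HZ.row (.inr (i, s)) (.inl (i', j))
            = (1 : Matrix ι ι F2) i i' * h s j := fun _ => rfl
        simp only [hfz, hrow, mul_left_comm (c _), mul_comm (c _), Pi.zero_apply]
        rw [← Finset.mul_sum, this, mul_zero]
      rw [SetLike.mem_coe, Submodule.mem_comap, this]
      exact zero_mem _
  · rintro _ (⟨z, hz, b, rfl⟩ | ⟨a, b, -, rfl⟩)
    · have : f (inL (tens z b)) = (c ⬝ᵥ b) • z := by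
        ext i
        simp [hfz, inL, tens, dotProduct, Finset.mul_sum, mul_comm, mul_left_comm]
      rw [SetLike.mem_coe, Submodule.mem_comap, this]
      exact Submodule.smul_mem _ _ (Submodule.mem_sup_right hz)
    · have : f (inR (tens a b)) = 0 := by
        ext i
        simp [hfz, inR]
      rw [SetLike.mem_coe, Submodule.mem_comap, this]
      exact zero_mem _

theorem hammingNorm_inL_tens (x : ι → F2) (v : B → F2) :
    hammingNorm (inL (tens x v) : (ι × B) ⊕ (rX × S) → F2) = hammingNorm x * hammingNorm v := by
  classical
  rw [hammingNorm, hammingNorm, hammingNorm, ← Finset.card_product]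
  symm
  rw [← Finset.card_map Function.Embedding.inl]
  congr 1
  ext (⟨i, j⟩ | p) <;>
    simp only [Finset.mem_map, Finset.mem_product, Finset.mem_filter, Finset.mem_univ, true_and] <;>
    simp [inL, tens]

theorem isLogicalX_inL_tens {x : ι → F2} (hx : C.IsLogicalX x) {v : B → F2} (hv : h *ᵥ v = 0)
    (hv0 : v ≠ 0) : (leftProduct C h).IsLogicalX (inL (tens x v)) := by
  refine ⟨?_, fun hmem => ?_⟩
  · simp [leftProduct, prodZ, fromBlocks_mulVec, inL, kronecker_mulVec_tens, hv, hx.1]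
  · obtain ⟨j, hj⟩ := Function.ne_iff.1 hv0
    refine hx.2 ((Submodule.smul_mem_iff _ hj).1 ?_)
    convert col_mem_groupX j hmem using 1
    ext i
    simp [inL, tens, mul_comm]

theorem isLogicalZ_inL_tens {z : ι → F2} (hz : C.IsLogicalZ z) {c : B → F2} (hc : h *ᵥ c = 0)
    {j : B} (hj : c j ≠ 0) :
    (leftProduct C h).IsLogicalZ (inL (tens z (Pi.single j 1))) := by
  refine ⟨?_, fun hmem => ?_⟩
  · simp [leftProduct, prodX, fromCols_mulVec, inL, kronecker_mulVec_tens, hz.1]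
  · refine hz.2 ((Submodule.smul_mem_iff _ hj).1 ?_)
    convert sum_smul_col_mem_groupZ hc hmem using 1
    ext i
    simp [inL, tens, Finset.sum_apply, Pi.single_apply]

/-- The columns of a logical `X` operator are logical for `C` throughout the support of a nonzero
codeword of `h`. -/
theorem exists_mem_ker_of_isLogicalX (hx : (leftProduct C h).IsLogicalX (sectors M N)) :
    ∃ v, h *ᵥ v = 0 ∧ v ≠ 0 ∧ ∀ j, v j ≠ 0 → C.IsLogicalX (M.col j) := by
  have hj : ∃ j, M.col j ∉ C.groupX := by
    by_contra! hj
    exact hx.2 (mem_leftProduct_groupX_of_col hx.1 hj)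
  obtain ⟨j, hj⟩ := hj
  obtain ⟨hHZ, hMN⟩ := (prodZ_mulVec_sectors _ _ _ _ _).1 hx.1
  -- a functional that separates column `j` from the gauge group, applied to all columns
  obtain ⟨φ, hφj, hφ⟩ := Submodule.exists_le_ker_of_notMem hj
  refine ⟨fun j => φ (M.col j), ?_, fun h0 => hφj (congrFun h0 j), fun j hj => ⟨?_, fun hm =>
    hj (hφ hm)⟩⟩
  · ext s
    have h1 : ∑ j, h s j • M.col j = N.col s ᵥ* C.HX := by
      ext i
      have := congrFun (congrFun hMN i) s
      simp only [mul_apply, transpose_apply] at this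
      simpa [vecMul, dotProduct, Finset.sum_apply, mul_comm] using this
    have h2 : φ (∑ j, h s j • M.col j) = 0 := by
      rw [h1]
      exact hφ (Submodule.mem_sup_left ((mem_span_row_iff _ _).2 ⟨_, rfl⟩))
    simpa [mulVec, dotProduct] using h2
  · ext r
    exact congrFun (congrFun hHZ r) j

theorem exists_mem_ker_of_isLogicalZ (hz : (leftProduct C h).IsLogicalZ (sectors M N)) :
    ∃ c, h *ᵥ c = 0 ∧ C.IsLogicalZ (M *ᵥ c) := by
  have hMN := (prodX_mulVec_sectors _ _ _ _).1 hz.1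
  by_contra! hc
  refine hz.2 (mem_leftProduct_groupZ_of_mulVec hz.1 fun c hc0 => ?_)
  by_contra hm
  refine hc c hc0 ⟨?_, hm⟩
  rw [mulVec_mulVec, hMN, ← mulVec_mulVec, hc0, mulVec_zero]

/-- If `K j` bounds the `X` distance of `C` for each logical column of some logical `X` operator, then
the sum of the `K j` bounds the `X` distance of the product. -/
theorem leftProduct_distX_le_sum (hx : (leftProduct C h).IsLogicalX (sectors M N)) (K : B → ℕ)
    (hK : ∀ j, C.IsLogicalX (M.col j) → C.distX ≤ K j) :
    (leftProduct C h).distX ≤ (∑ j, K j : ℕ) := by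
  obtain ⟨v, hv, hv0, hvM⟩ := exists_mem_ker_of_isLogicalX hx
  obtain ⟨j, hj⟩ := Function.ne_iff.1 hv0
  -- `y ⊗ v` with `y` of least weight is logical
  obtain ⟨y, hy, hyd⟩ := C.exists_hammingNorm_eq_distX (hvM j hj)
  refine (SubsystemCode.distX_le (isLogicalX_inL_tens hy hv hv0)).trans ?_
  rw [hammingNorm_inL_tens, Nat.cast_le, mul_comm, hammingNorm, ← smul_eq_mul, ← Finset.sum_const]
  refine (Finset.sum_le_sum fun j hj => ?_).trans (Finset.sum_le_univ_sum_of_nonneg (by simp))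
  have := hK j (hvM j (by simpa using hj))
  rwa [hyd, Nat.cast_le] at this

theorem leftProduct_distZ_le (hz : (leftProduct C h).IsLogicalZ (sectors M N)) :
    ∃ c : B → F2, C.IsLogicalZ (M *ᵥ c) ∧ (leftProduct C h).distZ ≤ C.distZ := by
  obtain ⟨c, hc, hcM⟩ := exists_mem_ker_of_isLogicalZ hz
  obtain ⟨y, hy, hyd⟩ := C.exists_hammingNorm_eq_distZ hcM
  have hc0 : c ≠ 0 := by
    rintro rfl
    exact hcM.2 (by simp)
  obtain ⟨j, hj⟩ := Function.ne_iff.1 hc0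
  refine ⟨c, hcM, (SubsystemCode.distZ_le (isLogicalZ_inL_tens hy hc hj)).trans ?_⟩
  have h1 : hammingNorm (Pi.single j 1 : B → F2) = 1 := by
    simp [hammingNorm, Pi.single_apply, Finset.filter_eq']
  rw [hammingNorm_inL_tens, hyd, h1, mul_one]

theorem sum_hammingNorm_col (x : ι × B → F2) :
    ∑ j, hammingNorm (fun i => x (i, j)) = hammingNorm x := by
  simpa [Pauli.supp, Pauli.comap, hammingNorm] using Circuit.sum_card_supp_column ((x, 0) : Pauli _)

theorem leftProduct_distX_le_left {x : (ι × B) ⊕ (rX × S) → F2}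
    (hx : (leftProduct C h).IsLogicalX x) :
    (leftProduct C h).distX ≤ hammingNorm (x ∘ Sum.inl) := by
  obtain ⟨M, N, rfl⟩ := exists_sectors x
  rw [← sum_hammingNorm_col]
  exact leftProduct_distX_le_sum hx _ fun j hj => SubsystemCode.distX_le hj

theorem leftProduct_distZ_le_left {z : (ι × B) ⊕ (rX × S) → F2}
    (hz : (leftProduct C h).IsLogicalZ z) :
    (leftProduct C h).distZ ≤ hammingNorm (z ∘ Sum.inl) := by
  obtain ⟨M, N, rfl⟩ := exists_sectors z
  obtain ⟨c, hc, hd⟩ := leftProduct_distZ_le hz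
  refine (hd.trans (SubsystemCode.distZ_le hc)).trans ?_
  rw [Nat.cast_le]
  -- each nonzero entry of `M *ᵥ c` comes from a nonzero row of `M`
  refine Finset.card_le_card_of_surjOn Prod.fst fun i hi => ?_
  simp only [Finset.coe_filter, Finset.mem_univ, true_and, Set.mem_ofPred_eq, mulVec,
    dotProduct] at hi
  obtain ⟨j, -, hj⟩ := Finset.exists_ne_zero_of_sum_ne_zero hi
  exact ⟨(i, j), Finset.mem_filter.2 ⟨Finset.mem_univ _, left_ne_zero_of_mul hj⟩, rfl⟩

end Product

/-! ### The hypergraph product as a product of classical codes -/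

section HGP

variable {B₁ S₁ B₂ S₂ : Type*} [Fintype B₁] [Fintype S₁] [Fintype B₂] [Fintype S₂]
  [DecidableEq B₁] [DecidableEq S₁] [DecidableEq B₂] [DecidableEq S₂]

/-- The classical code with check matrix `h`, as a CSS code without `Z` checks. -/
def classicalCode (h : Matrix S₁ B₁ F2) : SubsystemCode S₁ Empty B₁ where
  HX := h
  HZ := 0
  comm := by simp
  gaugeX := ⊥
  gaugeZ := ⊥
  gaugeX_comm := by simp
  gaugeZ_comm := by simp

theorem leftHGP_groupX (h₁ : Matrix S₁ B₁ F2) (h₂ : Matrix S₂ B₂ F2) :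
    (leftHGP h₁ h₂).groupX = (leftProduct (classicalCode h₁) h₂).groupX := by
  refine congrArg (Submodule.span F2 (Set.range (hgpX h₁ h₂).row) ⊔ ·) (le_antisymm
    (Submodule.span_mono fun _ hv => Or.inr hv) (Submodule.span_le.2 ?_))
  rintro _ (⟨x, hx, c, -, rfl⟩ | hv)
  · obtain rfl : x = 0 := hx
    rw [tens_zero_left, inL, Sum.elim_zero_zero]
    exact zero_mem _
  · exact Submodule.subset_span hv

theorem leftHGP_groupZ (h₁ : Matrix S₁ B₁ F2) (h₂ : Matrix S₂ B₂ F2) :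
    (leftHGP h₁ h₂).groupZ = (leftProduct (classicalCode h₁) h₂).groupZ := by
  have hrow : Set.range (leftProduct (classicalCode h₁) h₂).HZ.row
      = Set.range (leftHGP h₁ h₂).HZ.row := by
    ext v
    simp only [Set.mem_range, Sum.exists, Prod.exists, IsEmpty.exists_iff, false_or]
    rfl
  rw [SubsystemCode.groupZ, SubsystemCode.groupZ, hrow]
  refine congrArg (_ ⊔ ·) (le_antisymm
    (Submodule.span_mono fun _ hv => Or.inr hv) (Submodule.span_le.2 ?_))
  rintro _ (⟨x, hx, c, rfl⟩ | hv)
  · obtain rfl : x = 0 := hx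
    rw [tens_zero_left, inL, Sum.elim_zero_zero]
    exact zero_mem _
  · exact Submodule.subset_span hv

theorem leftHGP_isLogicalX (h₁ : Matrix S₁ B₁ F2) (h₂ : Matrix S₂ B₂ F2) :
    (leftHGP h₁ h₂).IsLogicalX = (leftProduct (classicalCode h₁) h₂).IsLogicalX := by
  ext x
  rw [SubsystemCode.IsLogicalX, SubsystemCode.IsLogicalX, leftHGP_groupX]
  refine and_congr_left fun _ => ?_
  simp only [leftHGP, leftProduct, hgpZ, prodZ, fromCols_mulVec, fromBlocks_mulVec,
    ← Sum.elim_zero_zero, Sum.elim_eq_iff]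
  exact ⟨fun hx => ⟨Subsingleton.elim _ _, hx⟩, fun hx => hx.2⟩

theorem leftHGP_isLogicalZ (h₁ : Matrix S₁ B₁ F2) (h₂ : Matrix S₂ B₂ F2) :
    (leftHGP h₁ h₂).IsLogicalZ = (leftProduct (classicalCode h₁) h₂).IsLogicalZ := by
  ext z
  rw [SubsystemCode.IsLogicalZ, SubsystemCode.IsLogicalZ, leftHGP_groupZ]
  rfl

theorem leftHGP_distX_le_left {h₁ : Matrix S₁ B₁ F2} {h₂ : Matrix S₂ B₂ F2}
    {x : (B₁ × B₂) ⊕ (S₁ × S₂) → F2} (hx : (leftHGP h₁ h₂).IsLogicalX x) :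
    (leftHGP h₁ h₂).distX ≤ hammingNorm (x ∘ Sum.inl) := by
  rw [leftHGP_isLogicalX] at hx
  rw [SubsystemCode.distX, leftHGP_isLogicalX]
  exact leftProduct_distX_le_left hx

theorem leftHGP_distZ_le_left {h₁ : Matrix S₁ B₁ F2} {h₂ : Matrix S₂ B₂ F2}
    {z : (B₁ × B₂) ⊕ (S₁ × S₂) → F2} (hz : (leftHGP h₁ h₂).IsLogicalZ z) :
    (leftHGP h₁ h₂).distZ ≤ hammingNorm (z ∘ Sum.inl) := by
  rw [leftHGP_isLogicalZ] at hz
  rw [SubsystemCode.distZ, leftHGP_isLogicalZ]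
  exact leftProduct_distZ_le_left hz

end HGP

/-! ### Distance-preserving circuits -/

namespace Circuit

/-- The fault distances never exceed the code distances, and the bound on errors of either type follows
from those on `X` and `Z`, so two lower bounds suffice. -/
theorem distancePreserving_of_le {ι rX rZ : Type*} [Fintype ι] [DecidableEq ι] [Fintype rX]
    [Fintype rZ] {C : SubsystemCode rX rZ ι} {c : Circuit ι}
    (hX : ∀ q N, Reach c q N → C.IsLogicalX q.1 → C.distX ≤ N)
    (hZ : ∀ q N, Reach c q N → C.IsLogicalZ q.2 → C.distZ ≤ N) : c.DistancePreserving C := by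
  have hX' : ∀ x : ι → F2, Reach c (x, 0) (hammingNorm x) := fun x => by
    simpa [Pauli.supp, hammingNorm] using reach_card_supp c (x, 0)
  have hZ' : ∀ z : ι → F2, Reach c (0, z) (hammingNorm z) := fun z => by
    simpa [Pauli.supp, hammingNorm] using reach_card_supp c (0, z)
  refine ⟨le_antisymm (le_sInf ?_) (le_faultDistance hX),
    le_antisymm (le_sInf ?_) (le_faultDistance hZ),
    le_antisymm (le_min (le_sInf ?_) (le_sInf ?_)) (le_faultDistance ?_)⟩
  · rintro _ ⟨x, hx, rfl⟩
    exact faultDistance_le (hX' x) hx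
  · rintro _ ⟨z, hz, rfl⟩
    exact faultDistance_le (hZ' z) hz
  · rintro _ ⟨x, hx, rfl⟩
    exact faultDistance_le (hX' x) ⟨hx.1, mulVec_zero _, Or.inl hx.2⟩
  · rintro _ ⟨z, hz, rfl⟩
    exact faultDistance_le (hZ' z) ⟨mulVec_zero _, hz.1, Or.inr hz.2⟩
  · rintro q N hq ⟨hx, hz, h | h⟩
    · exact (min_le_left _ _).trans (hX q N hq ⟨hx, h⟩)
    · exact (min_le_right _ _).trans (hZ q N hq ⟨hz, h⟩)

/-- If the left part of every logical operator already has the weight of the distance, then permuting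
the left sector is distance-preserving, whatever circuit runs on the right sector. -/
theorem distancePreserving_sum_permute {ι κ rX rZ : Type*} [Fintype ι] [DecidableEq ι]
    [Fintype κ] [DecidableEq κ] [Fintype rX] [Fintype rZ] {C : SubsystemCode rX rZ (ι ⊕ κ)}
    (hX : ∀ x, C.IsLogicalX x → C.distX ≤ hammingNorm (x ∘ Sum.inl))
    (hZ : ∀ z, C.IsLogicalZ z → C.distZ ≤ hammingNorm (z ∘ Sum.inl))
    (π : Equiv.Perm ι) (e : Circuit κ) :
    (Circuit.sum [Layer.permute π] e).DistancePreserving C := by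
  refine distancePreserving_of_le (fun q N hq h => ?_) (fun q N hq h => ?_)
  · refine (hX _ h).trans (Nat.cast_le.2 ?_)
    exact (Pauli.hammingNorm_fst_le (Pauli.comap Sum.inl q)).trans hq.left.card_supp_le_of_permute
  · refine (hZ _ h).trans (Nat.cast_le.2 ?_)
    exact (Pauli.hammingNorm_snd_le (Pauli.comap Sum.inl q)).trans hq.left.card_supp_le_of_permute

/-- Running a distance-preserving circuit of `C` in all columns of the left sector is
distance-preserving for the product, whatever circuit runs on the right sector. -/
theorem DistancePreserving.inheritedQ {rX rZ ι B S : Type*} [Fintype rX] [Fintype rZ] [Fintype ι]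
    [Fintype B] [Fintype S] [DecidableEq rX] [DecidableEq ι] [DecidableEq B] [DecidableEq S]
    {C : SubsystemCode rX rZ ι} {c : Circuit ι} (hc : c.DistancePreserving C)
    (d : Circuit (rX × S)) (h : Matrix S B F2) :
    (Circuit.inheritedQ (B := B) c d).DistancePreserving (leftProduct C h) := by
  refine distancePreserving_of_le (fun q N hq hx => ?_) (fun q N hq hz => ?_)
  -- for `X`, the distance of `C` is paid in each column of the support of a codeword
  · obtain ⟨K, hKN, hK⟩ := hq.left.column
    obtain ⟨M, R, hM⟩ := exists_sectors q.1
    rw [← hM] at hx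
    refine (leftProduct_distX_le_sum hx K fun j hj => ?_).trans (Nat.cast_le.2 hKN)
    rw [← hc.1]
    refine faultDistance_le (hK j) ?_
    simp only [Pauli.comap, ← hM]
    exact hj
  · obtain ⟨K, hKN, hK⟩ := hq.left.column
    obtain ⟨M, R, hM⟩ := exists_sectors q.2
    rw [← hM] at hz
    obtain ⟨b, hb, hd⟩ := leftProduct_distZ_le hz
    refine (hd.trans (le_of_eq_of_le hc.2.1.symm ?_)).trans (Nat.cast_le.2 hKN)
    -- superposing the columns selected by the codeword `b` makes `c` produce the logical `M *ᵥ b`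
    refine (faultDistance_le (Reach.sum (Finset.univ.filter fun j => b j = 1)
      fun j _ => hK j) ?_).trans (Nat.cast_le.2 (Finset.sum_le_univ_sum_of_nonneg (by simp)))
    convert hb using 1
    have hb' : ∀ t : F2, t = if t = 1 then 1 else 0 := by decide
    ext i
    rw [Prod.snd_sum, Finset.sum_apply, Finset.sum_filter, mulVec, dotProduct]
    refine Finset.sum_congr rfl fun j _ => ?_
    rw [hb' (b j)]
    by_cases h1 : b j = 1 <;> simp [h1, Pauli.comap, ← hM, sectors, vec]

end Circuit
end QGadget

theorem mainTheorem9
    {B₁ S₁ B₂ S₂ B S : Type*} [Fintype B₁] [Fintype S₁] [Fintype B₂] [Fintype S₂] [Fintype B]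
    [Fintype S] [DecidableEq B₁] [DecidableEq S₁] [DecidableEq B₂] [DecidableEq S₂]
    [DecidableEq B] [DecidableEq S]
    -- the classical check matrices
    (h₁ : Matrix S₁ B₁ QGadget.F2) (h₂ : Matrix S₂ B₂ QGadget.F2) (h : Matrix S B QGadget.F2)
    -- automorphisms `h₁ σ₁ = w₁ h₁`, `h₂ σ₂ = w₂ h₂`, `h σ = w h`
    (σ₁ : Equiv.Perm B₁) (w₁ : Matrix.GeneralLinearGroup S₁ QGadget.F2)
    (hσ₁ : h₁ * σ₁.permMatrix QGadget.F2 = w₁.val * h₁)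
    (σ₂ : Equiv.Perm B₂) (w₂ : Matrix.GeneralLinearGroup S₂ QGadget.F2)
    (hσ₂ : h₂ * σ₂.permMatrix QGadget.F2 = w₂.val * h₂)
    (σ : Equiv.Perm B) (w : Matrix.GeneralLinearGroup S QGadget.F2)
    (hσ : h * σ.permMatrix QGadget.F2 = w.val * h)
    -- the induced action `H_X U = W H_X` of the gadget `U = U₁ U₂` on the `X` checks
    (W : Matrix.GeneralLinearGroup (S₁ × B₂) QGadget.F2)
    (hW : QGadget.hgpX h₁ h₂ * (QGadget.hgpU₁ σ₁ w₁ * QGadget.hgpU₂ σ₂ w₂) =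
      W.val * QGadget.hgpX h₁ h₂) :
    -- gadgets inherited from distance-preserving gadgets of the quantum input
    (∀ c : QGadget.Circuit ((B₁ × B₂) ⊕ (S₁ × S₂)),
      c.mat = QGadget.hgpU₁ σ₁ w₁ * QGadget.hgpU₂ σ₂ w₂ →
      c.DistancePreserving (QGadget.leftHGP h₁ h₂) →
      ∀ d : QGadget.Circuit ((S₁ × B₂) × S), d.mat = W.val ⊗ₖ (1 : Matrix S S QGadget.F2) →
        (QGadget.Circuit.inheritedQ (B := B) c d).mat =
          QGadget.prodUQ B S (QGadget.hgpU₁ σ₁ w₁ * QGadget.hgpU₂ σ₂ w₂) W ∧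
        (QGadget.Circuit.inheritedQ (B := B) c d).DistancePreserving
          (QGadget.leftProduct (QGadget.leftHGP h₁ h₂) h)) ∧
    -- the standard circuits of the quantum input are such gadgets
    (∀ e : QGadget.Circuit (S₁ × S₂), e.mat = w₁.val ⊗ₖ (w₂⁻¹).valᵀ →
      (QGadget.Circuit.standardHGP σ₁ σ₂ e).mat =
        QGadget.hgpU₁ σ₁ w₁ * QGadget.hgpU₂ σ₂ w₂ ∧
      (QGadget.Circuit.standardHGP σ₁ σ₂ e).DistancePreserving (QGadget.leftHGP h₁ h₂)) ∧
    -- gadgets inherited from the classical input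
    (∀ e : QGadget.Circuit ((S₁ × B₂) × S),
      e.mat = (1 : Matrix (S₁ × B₂) (S₁ × B₂) QGadget.F2) ⊗ₖ (w⁻¹).valᵀ →
        (QGadget.Circuit.inheritedC ((B₁ × B₂) ⊕ (S₁ × S₂)) σ e).mat =
          QGadget.prodUc ((B₁ × B₂) ⊕ (S₁ × S₂)) (S₁ × B₂) σ w ∧
        (QGadget.Circuit.inheritedC ((B₁ × B₂) ⊕ (S₁ × S₂)) σ e).DistancePreserving
          (QGadget.leftProduct (QGadget.leftHGP h₁ h₂) h)) := by
  open QGadget in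
  refine ⟨fun c hc hdc d hd => ⟨?_, hdc.inheritedQ d h⟩, fun e he => ⟨?_, ?_⟩,
    fun e he => ⟨?_, ?_⟩⟩
  · rw [Circuit.inheritedQ, Circuit.mat_sum, Circuit.mat_parallel, hc, hd, prodUQ]
  · have hnil : Circuit.mat [Layer.permute (Equiv.prodCongr σ₁ σ₂)]
        = σ₁.permMatrix F2 ⊗ₖ σ₂.permMatrix F2 := by
      rw [Circuit.mat_cons, Circuit.mat_nil, Matrix.mul_one, Layer.mat_permute,
        permMatrix_prodCongr]
    rw [Circuit.standardHGP, Circuit.mat_sum, hnil, he, hgpU₁, hgpU₂]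
    simp [fromBlocks_multiply, ← mul_kronecker_mul]
  · exact Circuit.distancePreserving_sum_permute (fun _ => leftHGP_distX_le_left)
      (fun _ => leftHGP_distZ_le_left) _ e
  · have hone : Equiv.Perm.permMatrix F2 (Equiv.refl ((B₁ × B₂) ⊕ (S₁ × S₂))) = 1 :=
      permMatrix_one
    rw [Circuit.inheritedC, Circuit.mat_sum, Circuit.mat_cons, Circuit.mat_nil, Matrix.mul_one,
      Layer.mat_permute, permMatrix_prodCongr, hone, he, prodUc]
  · exact Circuit.distancePreserving_sum_permute (fun _ => leftProduct_distX_le_left)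
      (fun _ => leftProduct_distZ_le_left) _ e
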